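/- Let $p,n\ge 0$ be integers, $T^1,\dots,T^p>0$ and $T_0=[0,T^1]\times\dots\times[0,T^p]\subset\mathbb R^p$, with opposite faces $S_i^-=\{t\in T_0: t^i=0\}$ and $S_i^+=\{t\in T_0: t^i=T^i\}$, $i=1,\dots,p$. Let $C_T^\infty$ be the space of smooth functions $\mathbb R^p\to\mathbb R^n$ that are $T^\alpha$-periodic in $t^\alpha$ for every $\alpha$. Let $H^1_T$ be the Hilbert space of all $u\in L^2(T_0,\mathbb R^n)$ that have weak derivatives $\partial u/\partial t^\alpha\in L^2(T_0,\mathbb R^n)$, $\alpha=1,\dots,p$, in the sense that $\int_{T_0}\big(u,\frac{\partial f}{\partial t^\alpha}\big)\,dt=-\int_{T_0}\big(\frac{\partial u}{\partial t^\alpha},f\big)\,dt$ for all $f\in C^\infty_T$, with the inner product $\langle u,v\rangle=\int_{T_0}\big[(u,v)+\sum_\alpha\big(\frac{\partial u}{\partial t^\alpha},\frac{\partial v}{\partial t^\alpha}\big)\big]dt$. Let $F:T_0\times\mathbb R^n\to\mathbb R$ satisfy: 1. $F(t,x)$ is (Lebesgue) measurable in $t$ for every $x\in\mathbb R^n$ and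 continuously differentiable in $x$ for every $t\in T_0$, and there are $a\in C^1([0,\infty),[0,\infty))$ with $a'$ bounded above and $b\in C(T_0,[0,\infty))$ such that $|F(t,x)|\le a(|x|)\,b(t)$ and $|\nabla_xF(t,x)|\le a(|x|)\,b(t)$ for all $t\in T_0$, $x\in\mathbb R^n$; 2. $F(t,x)>0$ for all $t\in T_0$, $x\in\mathbb R^n$; 3. there are real numbers $P_1,\dots,P_n\neq 0$ such that $F(t,x+P_ie_i)=F(t,x)$ for all $i$, all $t\in T_0$ and all $x\in\mathbb R^n$, where $e_1,\dots,e_n$ is the canonical basis of $\mathbb R^n$; 4. the functional $\varphi_1(u)=\int_{T_0}F(t,u(t))\,dt$ is weakly lower semicontinuous on $H^1_T$, that is, $\varphi_1(u)\le\liminf_k\varphi_1(u_k)$ whenever $u_k\to u$ weakly in $H^1_T$. Then there is a $u\in H^1_T$ that minimizes the action $$\varphi(u)=\int_{T_0}\Big[\tfrac12\Big|\frac{\partial u}{\partial t}\Big|^2+F(t,u(t))\Big]dt,\qquad \Big|\frac{\partial u}{\partial t}\Big|^2=\sum_{\alpha}\Big|\frac{\partial u}{\partial t^\alpha}\Big|^2,$$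 over $H^1_T$ and that solves the problem $$\Delta u(t)=\nabla_x F(t,u(t))\ \text{ for a.e. } t\in T_0,\qquad u|_{S_i^-}=u|_{S_i^+},\quad \frac{\partial u}{\partial t}\Big|_{S_i^-}=\frac{\partial u}{\partial t}\Big|_{S_i^+}\quad(i=1,\dots,p).$$ Here $\Delta u\in L^2(T_0,\mathbb R^n)$ is the weak Laplacian, defined by $\int_{T_0}\sum_\alpha\big(\frac{\partial u}{\partial t^\alpha},\frac{\partial f}{\partial t^\alpha}\big)dt=-\int_{T_0}(\Delta u,f)\,dt$ for all $f\in C_T^\infty$, and the boundary values of $u$ and of each $\partial u/\partial t^\alpha$ are $L^2$ traces: $g\in L^2(S)$ is the trace of $w\in L^2(T_0,\mathbb R^n)$ on a face $S$ if $\frac1h\int_{\{t\in T_0:\,\mathrm{dist}(t,S)\le h\}}|w(t)-g(\pi_S t)|^2\,dt\to0$ as $h\to0^+$, where $\pi_S$ is the orthogonal projection onto $S$; traces on opposite faces are compared at opposite points. -/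

import Mathlib

open MeasureTheory Filter Topology Set
open scoped ContDiff ENNReal

noncomputable section

namespace PoissonGradient

/-- The Euclidean space `ℝ^d`. -/
abbrev E (d : ℕ) : Type := EuclideanSpace ℝ (Fin d)

variable {p n : ℕ}

/-- The box `T₀ = [0,T¹] × ... × [0,Tᵖ]`. -/
def box (T : Fin p → ℝ) : Set (E p) := {t | ∀ α, t α ∈ Icc 0 (T α)}

/-- Lebesgue measure on `T₀`. -/
def boxMeasure (T : Fin p → ℝ) : Measure (E p) := volume.restrict (box T)

/-- The space `L²(T₀, ℝⁿ)`. -/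
abbrev L2Box (T : Fin p → ℝ) (n : ℕ) : Type := Lp (E n) 2 (boxMeasure T)

/-- The space `C_T^∞` of smooth functions `ℝᵖ → ℝⁿ` that are `T^α`-periodic in each `t^α`. -/
structure IsTestFunction (T : Fin p → ℝ) (f : E p → E n) : Prop where
  smooth : ContDiff ℝ ∞ f
  periodic : ∀ (α : Fin p) (t : E p), f (t + EuclideanSpace.single α (T α)) = f t

/-- The classical partial derivative `∂f/∂t^α`. -/
def partialDeriv (α : Fin p) (f : E p → E n) (t : E p) : E n :=
  fderiv ℝ f t (EuclideanSpace.single α 1)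

/-- `v` is the weak derivative of `u` in the direction `t^α`, tested with `C_T^∞`. -/
def IsWeakPartialDeriv (T : Fin p → ℝ) (α : Fin p) (u v : L2Box T n) : Prop :=
  ∀ f : E p → E n, IsTestFunction T f →
    ∫ t, inner ℝ (u t) (partialDeriv α f t) ∂(boxMeasure T)
      = - ∫ t, inner ℝ (v t) (f t) ∂(boxMeasure T)

theorem isCompact_box (T : Fin p → ℝ) : IsCompact (box T) := by
  have h : box T = (EuclideanSpace.equiv (Fin p) ℝ).toHomeomorph ⁻¹'
      (Set.pi univ fun α => Icc 0 (T α)) := by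
    ext t
    exact ⟨fun ht α _ => ht α, fun ht α => ht α (mem_univ α)⟩
  rw [h, Homeomorph.isCompact_preimage]
  exact isCompact_univ_pi fun _ => isCompact_Icc

theorem integrable_inner_continuous (T : Fin p → ℝ) (u : L2Box T n) {g : E p → E n}
    (hg : Continuous g) : Integrable (fun t => inner ℝ (u t) (g t)) (boxMeasure T) := by
  have : IsFiniteMeasure (boxMeasure T) :=
    ⟨by simpa [boxMeasure] using (isCompact_box T).measure_lt_top⟩
  obtain ⟨C, hC⟩ := (isCompact_box T).exists_bound_of_continuousOn hg.continuousOn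
  have hgm : MemLp g 2 (boxMeasure T) := by
    refine MemLp.of_bound hg.aestronglyMeasurable C ?_
    exact ae_restrict_of_forall_mem (isCompact_box T).isClosed.measurableSet hC
  refine (L2.integrable_inner (𝕜 := ℝ) u (hgm.toLp g)).congr ?_
  filter_upwards [hgm.coeFn_toLp] with t ht
  rw [ht]

theorem IsTestFunction.continuous_partialDeriv {T : Fin p → ℝ} {f : E p → E n}
    (hf : IsTestFunction T f) (α : Fin p) : Continuous (partialDeriv α f) :=
  (hf.smooth.continuous_fderiv (by simp)).clm_apply continuous_const

/-- The Hilbert space `H¹_T`: its elements are the `u ∈ L²(T₀, ℝⁿ)` that have weak derivatives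
`∂u/∂t^α ∈ L²(T₀, ℝⁿ)`, recorded together with these (uniquely determined) derivatives.
The inner product is the one of the `ℓ²`-product of the spaces `L²(T₀, ℝⁿ)`, that is,
`⟨u, v⟩ = ∫ (u, v) + ∑ α, (∂u/∂t^α, ∂v/∂t^α)`. -/
def H1T (T : Fin p → ℝ) (n : ℕ) :
    Submodule ℝ (WithLp 2 (L2Box T n × PiLp 2 fun _ : Fin p => L2Box T n)) where
  carrier := {w | ∀ α, IsWeakPartialDeriv T α w.fst (w.snd α)}
  zero_mem' := by
    intro α f hf
    have h : ∀ᵐ t ∂(boxMeasure T), (0 : L2Box T n) t = 0 := Lp.coeFn_zero _ _ _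
    have h1 : ∫ t, inner ℝ ((0 : L2Box T n) t) (partialDeriv α f t) ∂(boxMeasure T) = 0 :=
      integral_eq_zero_of_ae (h.mono fun t ht => by
        change inner ℝ ((0 : L2Box T n) t) _ = 0
        rw [ht, inner_zero_left])
    have h2 : ∫ t, inner ℝ ((0 : L2Box T n) t) (f t) ∂(boxMeasure T) = 0 :=
      integral_eq_zero_of_ae (h.mono fun t ht => by
        change inner ℝ ((0 : L2Box T n) t) _ = 0
        rw [ht, inner_zero_left])
    change ∫ t, inner ℝ ((0 : L2Box T n) t) (partialDeriv α f t) ∂(boxMeasure T)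
      = - ∫ t, inner ℝ ((0 : L2Box T n) t) (f t) ∂(boxMeasure T)
    rw [h1, h2, neg_zero]
  add_mem' := by
    intro w z hw hz α f hf
    have key : ∀ (a b : L2Box T n) (g : E p → E n), Continuous g →
        ∫ t, inner ℝ ((a + b : L2Box T n) t) (g t) ∂(boxMeasure T)
          = ∫ t, inner ℝ (a t) (g t) ∂(boxMeasure T)
            + ∫ t, inner ℝ (b t) (g t) ∂(boxMeasure T) := by
      intro a b g hg
      rw [← integral_add (integrable_inner_continuous T a hg)
        (integrable_inner_continuous T b hg)]
      refine integral_congr_ae ?_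
      filter_upwards [Lp.coeFn_add a b] with t ht
      rw [ht, Pi.add_apply, inner_add_left]
    change ∫ t, inner ℝ ((w.fst + z.fst : L2Box T n) t) (partialDeriv α f t) ∂(boxMeasure T)
      = - ∫ t, inner ℝ ((w.snd α + z.snd α : L2Box T n) t) (f t) ∂(boxMeasure T)
    rw [key _ _ _ (hf.continuous_partialDeriv α), key _ _ _ hf.smooth.continuous,
      hw α f hf, hz α f hf, neg_add]
  smul_mem' := by
    intro c w hw α f hf
    have key : ∀ (a : L2Box T n) (g : E p → E n),
        ∫ t, inner ℝ ((c • a : L2Box T n) t) (g t) ∂(boxMeasure T)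
          = c * ∫ t, inner ℝ (a t) (g t) ∂(boxMeasure T) := by
      intro a g
      rw [← integral_const_mul]
      refine integral_congr_ae ?_
      filter_upwards [Lp.coeFn_smul c a] with t ht
      rw [ht, Pi.smul_apply, real_inner_smul_left]
    change ∫ t, inner ℝ ((c • w.fst : L2Box T n) t) (partialDeriv α f t) ∂(boxMeasure T)
      = - ∫ t, inner ℝ ((c • w.snd α : L2Box T n) t) (f t) ∂(boxMeasure T)
    rw [key, key, hw α f hf, mul_neg]

/-- The function `u ∈ L²(T₀, ℝⁿ)` underlying an element of `H¹_T`. -/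
def toL2 {T : Fin p → ℝ} (u : H1T T n) : L2Box T n := u.1.fst

/-- The weak derivative `∂u/∂t^α` of an element of `H¹_T`. -/
def wderiv {T : Fin p → ℝ} (u : H1T T n) (α : Fin p) : L2Box T n := u.1.snd α

/-- The functional `φ₁(u) = ∫_{T₀} F(t, u(t)) dt`. -/
def potentialAction (T : Fin p → ℝ) (F : E p → E n → ℝ) (u : H1T T n) : ℝ :=
  ∫ t, F t (toL2 u t) ∂(boxMeasure T)

/-- The action `φ(u) = ∫_{T₀} (½ |∂u/∂t|² + F(t, u(t))) dt`. -/
def action (T : Fin p → ℝ) (F : E p → E n → ℝ) (u : H1T T n) : ℝ :=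
  ∫ t, ((1 / 2) * (∑ α, ‖wderiv u α t‖ ^ 2) + F t (toL2 u t)) ∂(boxMeasure T)

/-- Weak lower semicontinuity (along weakly convergent sequences) of a real functional. -/
def IsWeaklyLSC {H : Type*} [NormedAddCommGroup H] [NormedSpace ℝ H] (φ : H → ℝ) : Prop :=
  ∀ (u : ℕ → H) (v : H),
    (∀ l : H →L[ℝ] ℝ, Tendsto (fun k => l (u k)) atTop (𝓝 (l v))) →
      ((φ v : ℝ) : EReal) ≤ liminf (fun k => ((φ (u k) : ℝ) : EReal)) atTop

/-- `w ∈ L²(T₀, ℝⁿ)` is the weak Laplacian `Δu` of `u ∈ H¹_T` (the weak divergence of the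
Jacobian matrix `∂u/∂t`), tested with `C_T^∞`. -/
def IsWeakLaplacian (T : Fin p → ℝ) (u : H1T T n) (w : L2Box T n) : Prop :=
  ∀ f : E p → E n, IsTestFunction T f →
    ∫ t, ∑ α, inner ℝ (wderiv u α t) (partialDeriv α f t) ∂(boxMeasure T)
      = - ∫ t, inner ℝ (w t) (f t) ∂(boxMeasure T)

/-- The projection of `ℝᵖ` onto the hyperplane `t^i = c`, along the `i`-th axis. -/
def faceProj (i : Fin p) (c : ℝ) (t : E p) : E p := WithLp.toLp 2 (Function.update t.ofLp i c)

/-- The function `g`, of which only the values on the face `t^i = c` of `T₀` matter, is in `L²`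
of this face and is the trace of `w` there: the mean over the layer of thickness `h` at the
face of the squared distance between `w` and the extension of `g` constant along the `i`-th axis
tends to `0` with `h`. -/
def IsTrace (T : Fin p → ℝ) (w : L2Box T n) (i : Fin p) (c : ℝ) (g : E p → E n) : Prop :=
  MemLp (fun t => g (faceProj i c t)) 2 (boxMeasure T) ∧
    Tendsto (fun h : ℝ => (ENNReal.ofReal h)⁻¹ *
        ∫⁻ t in {t : E p | |t i - c| ≤ h}, ‖w t - g (faceProj i c t)‖ₑ ^ 2 ∂(boxMeasure T))
      (𝓝[>] 0) (𝓝 0)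

/-- `w` has traces on the opposite faces `S_i^- : t^i = 0` and `S_i^+ : t^i = T^i`, and these
agree (almost everywhere) at opposite points: `w|S_i^- = w|S_i^+`. -/
def EqualTraces (T : Fin p → ℝ) (w : L2Box T n) (i : Fin p) : Prop :=
  ∃ g₀ g₁ : E p → E n, IsTrace T w i 0 g₀ ∧ IsTrace T w i (T i) g₁ ∧
    ∀ᵐ t ∂(boxMeasure T), g₀ (faceProj i 0 t) = g₁ (faceProj i (T i) t)

/-- `u` solves `Δu = ∇F(t, u)` almost everywhere on `T₀`, with
`u|S_i^- = u|S_i^+` and `∂u/∂t|S_i^- = ∂u/∂t|S_i^+` for all `i`. -/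
structure IsSolution (T : Fin p → ℝ) (F : E p → E n → ℝ) (u : H1T T n) : Prop where
  equation : ∃ w : L2Box T n, IsWeakLaplacian T u w ∧
    ∀ᵐ t ∂(boxMeasure T), w t = gradient (F t) (toL2 u t)
  boundary : ∀ i, EqualTraces T (toL2 u) i
  boundary_deriv : ∀ i α, EqualTraces T (wderiv u α) i

end PoissonGradient

end

noncomputable section

namespace PoissonGradient

variable {p n : ℕ} {T : Fin p → ℝ}

/-! Existence is the direct method. Modulo the lattice spanned by the vectors `P i • e i`, every
point of `ℝⁿ` lies in a fixed ball, so `F` and its gradient are bounded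
(`exists_bound_of_periodic`). Adding a lattice constant to `u` changes neither its derivatives nor
the potential, so a minimizing sequence may be taken with bounded integrals (`exists_translate`).
Positivity of `F` bounds the derivatives, and `poincare_wirtinger` then bounds the `H¹` norm. Along
a weakly convergent subsequence the potential is lower semicontinuous by hypothesis and the kinetic
term by convexity (`exists_minimizer`). The derivative of the action along a test function vanishes
at the minimizer, and this says that the bounded function `∇F(t, u)` is the weak Laplacian.

For the boundary conditions, periodic test functions are dense in `H¹_T`, have the same values on
opposite faces, and obey a layer estimate that survives `H¹` limits; hence every element of `H¹_T`
has equal traces (`equalTraces_toL2`). The derivatives of `u` have equal traces because they lie in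
`H¹_T` themselves: on Fourier coefficients `|ω_α ω_β| ≤ |ω|²`, so `Δu ∈ L²` controls all second
derivatives (`exists_toL2_eq_wderiv`).

Parseval's identity `hasSum_fourier`, transported from the unit torus, yields the density, the
Poincaré–Wirtinger inequality and this regularity: on the real modes a weak derivative is
multiplication by a frequency. -/

instance isFiniteMeasure_boxMeasure : IsFiniteMeasure (boxMeasure T) :=
  ⟨by simpa [boxMeasure] using (isCompact_box T).measure_lt_top⟩

theorem measurableSet_box : MeasurableSet (box T) := (isCompact_box T).isClosed.measurableSet

theorem ae_mem_box : ∀ᵐ t ∂(boxMeasure T), t ∈ box T := ae_restrict_mem measurableSet_box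

/-- A continuous function is square integrable on the box. -/
theorem memLp_of_continuous {g : E p → E n} (hg : Continuous g) : MemLp g 2 (boxMeasure T) := by
  obtain ⟨C, hC⟩ := (isCompact_box T).exists_bound_of_continuousOn hg.continuousOn
  exact MemLp.of_bound hg.aestronglyMeasurable C (ae_restrict_of_forall_mem measurableSet_box hC)

theorem inner_toLp {g : E p → E n} (hg : MemLp g 2 (boxMeasure T)) (u : L2Box T n) :
    inner ℝ u (hg.toLp g) = ∫ t, inner ℝ (u t) (g t) ∂(boxMeasure T) := by
  rw [L2.inner_def]
  refine integral_congr_ae ?_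
  filter_upwards [hg.coeFn_toLp] with t ht
  rw [ht]

/-! ### Test functions in `L²`; weak derivatives as inner product identities. -/

/-- The space of smooth periodic functions. -/
def testFunctions (T : Fin p → ℝ) (n : ℕ) : Submodule ℝ (E p → E n) where
  carrier := {f | IsTestFunction T f}
  zero_mem' := ⟨contDiff_const, fun _ _ => rfl⟩
  add_mem' hf hg := ⟨hf.smooth.add hg.smooth, fun α t => by
    simp only [Pi.add_apply, hf.periodic, hg.periodic]⟩
  smul_mem' c f hf := ⟨contDiff_const.smul hf.smooth, fun α t => by
    simp only [Pi.smul_apply, hf.periodic]⟩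

theorem isTest (f : testFunctions T n) : IsTestFunction T f.1 := f.2

theorem differentiable_test (f : testFunctions T n) : Differentiable ℝ f.1 :=
  (isTest f).smooth.differentiable (by simp)

/-- The class of a test function in `L²`. -/
def testL2 : testFunctions T n →ₗ[ℝ] L2Box T n where
  toFun f := (memLp_of_continuous (isTest f).smooth.continuous).toLp f.1
  map_add' _ _ := rfl
  map_smul' _ _ := rfl

/-- The class in `L²` of a classical partial derivative of a test function. -/
def testDeriv (α : Fin p) : testFunctions T n →ₗ[ℝ] L2Box T n where
  toFun f := (memLp_of_continuous ((isTest f).continuous_partialDeriv α)).toLp (partialDeriv α f.1)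
  map_add' f g := by
    rw [← MemLp.toLp_add]
    congr 1
    funext t
    simp [partialDeriv, fderiv_add ((differentiable_test f) t) ((differentiable_test g) t)]
  map_smul' c f := by
    rw [RingHom.id_apply, ← MemLp.toLp_const_smul]
    congr 1
    funext t
    simp [partialDeriv, fderiv_const_smul ((differentiable_test f) t)]

theorem coeFn_testL2 (f : testFunctions T n) : testL2 f =ᵐ[boxMeasure T] f.1 :=
  MemLp.coeFn_toLp (memLp_of_continuous (isTest f).smooth.continuous)

theorem coeFn_testDeriv (α : Fin p) (f : testFunctions T n) :
    testDeriv α f =ᵐ[boxMeasure T] partialDeriv α f.1 :=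
  MemLp.coeFn_toLp (memLp_of_continuous ((isTest f).continuous_partialDeriv α))

theorem inner_testL2 (u : L2Box T n) (f : testFunctions T n) :
    inner ℝ u (testL2 f) = ∫ t, inner ℝ (u t) (f.1 t) ∂(boxMeasure T) :=
  inner_toLp (memLp_of_continuous (isTest f).smooth.continuous) u

theorem inner_testDeriv (α : Fin p) (u : L2Box T n) (f : testFunctions T n) :
    inner ℝ u (testDeriv α f) = ∫ t, inner ℝ (u t) (partialDeriv α f.1 t) ∂(boxMeasure T) :=
  inner_toLp (memLp_of_continuous ((isTest f).continuous_partialDeriv α)) u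

theorem isWeakPartialDeriv_iff {α : Fin p} {u v : L2Box T n} :
    IsWeakPartialDeriv T α u v ↔
      ∀ f : testFunctions T n, inner ℝ u (testDeriv α f) = -inner ℝ v (testL2 f) := by
  constructor
  · intro h f
    rw [inner_testDeriv, inner_testL2]
    exact h f.1 f.2
  · intro h f hf
    have := h ⟨f, hf⟩
    rwa [inner_testDeriv, inner_testL2] at this

theorem isWeakLaplacian_iff {u : H1T T n} {w : L2Box T n} :
    IsWeakLaplacian T u w ↔
      ∀ f : testFunctions T n,
        ∑ α, inner ℝ (wderiv u α) (testDeriv α f) = -inner ℝ w (testL2 f) := by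
  have key : ∀ f : testFunctions T n, ∑ α, inner ℝ (wderiv u α) (testDeriv α f) =
      ∫ t, ∑ α, inner ℝ (wderiv u α t) (partialDeriv α f.1 t) ∂(boxMeasure T) := fun f => by
    rw [integral_finsetSum _ fun α _ =>
      integrable_inner_continuous T _ ((isTest f).continuous_partialDeriv α)]
    simp only [inner_testDeriv]
  constructor
  · intro h f
    rw [key, inner_testL2]
    exact h f.1 f.2
  · intro h f hf
    have := h ⟨f, hf⟩
    rwa [key, inner_testL2] at this

/-! ### Periodic integration by parts and test functions in `H¹_T`. -/

theorem box_eq_preimage : box T = WithLp.ofLp ⁻¹' Icc (0 : Fin p → ℝ) T := by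
  ext t
  simp [box, Pi.le_def, forall_and]

theorem integral_boxMeasure {G : Type*} [NormedAddCommGroup G] [NormedSpace ℝ G] (g : E p → G) :
    ∫ t, g t ∂(boxMeasure T) = ∫ x in Icc (0 : Fin p → ℝ) T, g (WithLp.toLp 2 x) := by
  rw [boxMeasure, box_eq_preimage]
  exact (PiLp.volume_preserving_ofLp (Fin p)).setIntegral_preimage_emb
    (MeasurableEquiv.toLp 2 (Fin p → ℝ)).symm.measurableEmbedding
    (fun x => g (WithLp.toLp 2 x)) _

/-- Divergence theorem for the vector field `h e_α`: only the two faces orthogonal to the `α`-th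
axis contribute, and their terms cancel by periodicity. -/
theorem integral_periodic_deriv_eq_zero (hT : ∀ α, 0 < T α) (α : Fin p) {h : E p → ℝ}
    (hh : ContDiff ℝ 1 h) (hper : ∀ t, h (t + EuclideanSpace.single α (T α)) = h t) :
    ∫ t, fderiv ℝ h t (EuclideanSpace.single α 1) ∂(boxMeasure T) = 0 := by
  rw [integral_boxMeasure]
  obtain _ | m := p
  · exact α.elim0
  let L : (Fin (m + 1) → ℝ) →L[ℝ] E (m + 1) :=
    (EuclideanSpace.equiv (Fin (m + 1)) ℝ).symm.toContinuousLinearMap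
  have hL : ∀ x, L x = WithLp.toLp 2 x := fun _ => rfl
  have hle : (0 : Fin (m + 1) → ℝ) ≤ T := fun i => (hT i).le
  have hcont : Continuous fun x => fderiv ℝ h (L x) := by
    have := hh.continuous_fderiv (by simp)
    fun_prop
  have key := integral_divergence_of_hasFDerivAt_off_countable' (0 : Fin (m + 1) → ℝ) T hle
    (fun i x => if i = α then h (L x) else 0)
    (fun i x => if i = α then (fderiv ℝ h (L x)).comp L else 0) ∅ countable_empty
    (fun i => by
      by_cases hi : i = α
      · simpa [hi, Function.comp_def] using (hh.continuous.comp L.continuous).continuousOn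
      · simpa [hi] using continuousOn_const)
    (fun x _ i => by
      by_cases hi : i = α
      · simpa [hi, Function.comp_def] using
          ((hh.differentiable (by simp)) (L x)).hasFDerivAt.comp x L.hasFDerivAt
      · simpa [hi] using hasFDerivAt_const _ _)
    (by
      refine Continuous.integrableOn_Icc (continuous_finsetSum _ fun i _ => ?_)
      by_cases hi : i = α
      · simp only [hi, if_true, ContinuousLinearMap.comp_apply]
        fun_prop
      · simpa [hi] using continuous_const)
  have hsum : ∀ x, (∑ i, (if i = α then (fderiv ℝ h (L x)).comp L else 0) (Pi.single i 1)) =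
      fderiv ℝ h (WithLp.toLp 2 x) (EuclideanSpace.single α 1) := by
    intro x
    rw [Finset.sum_eq_single α]
    · simp [hL]
    · intro i _ hi
      simp [hi]
    · simp
  simp only [hsum] at key
  rw [key]
  refine Finset.sum_eq_zero fun i _ => ?_
  by_cases hi : i = α
  · subst hi
    rw [sub_eq_zero]
    refine setIntegral_congr_fun measurableSet_Icc fun x _ => ?_
    simp only [if_true, hL]
    rw [← hper (WithLp.toLp 2 (i.insertNth ((0 : Fin (m + 1) → ℝ) i) x))]
    congr 1
    ext j
    refine Fin.succAboveCases i ?_ (fun k => ?_) j <;> simp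
  · simp [hi]

/-- Test functions have their classical partial derivatives as weak partial derivatives. -/
theorem isWeakPartialDeriv_test (hT : ∀ α, 0 < T α) (α : Fin p) (f : testFunctions T n) :
    IsWeakPartialDeriv T α (testL2 f) (testDeriv α f) := by
  rw [isWeakPartialDeriv_iff]
  intro g
  rw [inner_testDeriv, inner_testL2, eq_neg_iff_add_eq_zero,
    ← integral_add (integrable_inner_continuous T _ ((isTest g).continuous_partialDeriv α))
      (integrable_inner_continuous T _ (isTest g).smooth.continuous)]
  have h1 : ContDiff ℝ 1 fun t => inner ℝ (f.1 t) (g.1 t) :=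
    ((isTest f).smooth.inner ℝ (isTest g).smooth).of_le (by simp)
  rw [← integral_periodic_deriv_eq_zero hT α h1 fun t => by
    rw [(isTest f).periodic, (isTest g).periodic]]
  refine integral_congr_ae ?_
  filter_upwards [coeFn_testL2 f, coeFn_testDeriv α f] with t h1 h2
  rw [h1, h2, fderiv_inner_apply ℝ ((differentiable_test f) t) ((differentiable_test g) t)]
  rfl

/-- The element of `H¹_T` given by a test function. -/
def testH1 (hT : ∀ α, 0 < T α) : testFunctions T n →ₗ[ℝ] H1T T n where
  toFun f := ⟨WithLp.toLp 2 (testL2 f, WithLp.toLp 2 fun α => testDeriv α f),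
    fun α => isWeakPartialDeriv_test hT α f⟩
  map_add' f g := by
    ext1
    simp only [map_add, Submodule.coe_add]
    rfl
  map_smul' c f := by
    ext1
    simp only [map_smul, Submodule.coe_smul]
    rfl

@[simp] theorem toL2_testH1 (hT : ∀ α, 0 < T α) (f : testFunctions T n) :
    toL2 (testH1 hT f) = testL2 f := rfl

@[simp] theorem wderiv_testH1 (hT : ∀ α, 0 < T α) (f : testFunctions T n) (α : Fin p) :
    wderiv (testH1 hT f) α = testDeriv α f := rfl

@[simp] theorem toL2_add (u v : H1T T n) : toL2 (u + v) = toL2 u + toL2 v := rfl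
@[simp] theorem toL2_sub (u v : H1T T n) : toL2 (u - v) = toL2 u - toL2 v := rfl
@[simp] theorem wderiv_add (u v : H1T T n) (α) : wderiv (u + v) α = wderiv u α + wderiv v α := rfl
@[simp] theorem wderiv_sub (u v : H1T T n) (α) : wderiv (u - v) α = wderiv u α - wderiv v α := rfl
@[simp] theorem wderiv_smul (c : ℝ) (u : H1T T n) (α) : wderiv (c • u) α = c • wderiv u α := rfl

theorem H1T_inner (u v : H1T T n) :
    inner ℝ u v = inner ℝ (toL2 u) (toL2 v) + ∑ α, inner ℝ (wderiv u α) (wderiv v α) := by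
  rw [Submodule.coe_inner, WithLp.prod_inner_apply, PiLp.inner_apply]
  rfl

theorem H1T_norm_sq (u : H1T T n) : ‖u‖ ^ 2 = ‖toL2 u‖ ^ 2 + ∑ α, ‖wderiv u α‖ ^ 2 := by
  simp only [← real_inner_self_eq_norm_sq, H1T_inner]

theorem isWeakPartialDeriv_wderiv (u : H1T T n) (α : Fin p) :
    IsWeakPartialDeriv T α (toL2 u) (wderiv u α) := u.2 α

/-! ### Real Fourier modes of the box. -/

/-- The angular frequencies of the Fourier modes of the box. -/
def freq (T : Fin p → ℝ) (k : Fin p → ℤ) (α : Fin p) : ℝ := 2 * Real.pi * k α / T α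

/-- The phase of a Fourier mode. -/
def phase (T : Fin p → ℝ) (k : Fin p → ℤ) : E p →L[ℝ] ℝ :=
  ∑ α, freq T k α • EuclideanSpace.proj α

theorem phase_apply (k : Fin p → ℤ) (t : E p) : phase T k t = ∑ α, freq T k α * t α := by
  simp [phase]

theorem phase_single (k : Fin p → ℤ) (α : Fin p) (r : ℝ) :
    phase T k (EuclideanSpace.single α r) = freq T k α * r := by
  simp [phase_apply]

theorem phase_add_period (k : Fin p → ℤ) (α : Fin p) (t : E p) :
    ∃ m : ℤ, phase T k (t + EuclideanSpace.single α (T α)) = phase T k t + m * (2 * Real.pi) := by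
  rw [map_add, phase_single]
  by_cases h : T α = 0
  · exact ⟨0, by simp [h]⟩
  · exact ⟨k α, by rw [freq]; field_simp⟩

/-- The cosine Fourier mode in the direction of a basis vector. -/
def cosMode (T : Fin p → ℝ) (k : Fin p → ℤ) (j : Fin n) : testFunctions T n :=
  ⟨fun t => Real.cos (phase T k t) • EuclideanSpace.single j 1,
    ((Real.contDiff_cos.comp (phase T k).contDiff).smul contDiff_const), fun α t => by
      obtain ⟨m, hm⟩ := phase_add_period (T := T) k α t
      rw [hm, Real.cos_add_int_mul_two_pi]⟩

/-- The sine Fourier mode in the direction of a basis vector. -/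
def sinMode (T : Fin p → ℝ) (k : Fin p → ℤ) (j : Fin n) : testFunctions T n :=
  ⟨fun t => Real.sin (phase T k t) • EuclideanSpace.single j 1,
    ((Real.contDiff_sin.comp (phase T k).contDiff).smul contDiff_const), fun α t => by
      obtain ⟨m, hm⟩ := phase_add_period (T := T) k α t
      rw [hm, Real.sin_add_int_mul_two_pi]⟩

theorem testDeriv_eq_testL2 {α : Fin p} {f g : testFunctions T n}
    (h : ∀ t, partialDeriv α f.1 t = g.1 t) : testDeriv α f = testL2 g := by
  refine Lp.ext ?_
  filter_upwards [coeFn_testDeriv α f, coeFn_testL2 g] with t h1 h2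
  rw [h1, h2, h]

theorem testDeriv_cosMode (α : Fin p) (k : Fin p → ℤ) (j : Fin n) :
    testDeriv α (cosMode T k j) = -freq T k α • testL2 (sinMode T k j) := by
  rw [← map_smul]
  refine testDeriv_eq_testL2 fun t => ?_
  have h := ((phase T k).hasFDerivAt (x := t)).cos.smul_const (EuclideanSpace.single j (1 : ℝ))
  simp only [partialDeriv, cosMode]
  rw [h.fderiv]
  simp [phase_single, smul_smul, sinMode, mul_comm]

theorem testDeriv_sinMode (α : Fin p) (k : Fin p → ℤ) (j : Fin n) :
    testDeriv α (sinMode T k j) = freq T k α • testL2 (cosMode T k j) := by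
  rw [← map_smul]
  refine testDeriv_eq_testL2 fun t => ?_
  have h := ((phase T k).hasFDerivAt (x := t)).sin.smul_const (EuclideanSpace.single j (1 : ℝ))
  simp only [partialDeriv, sinMode]
  rw [h.fderiv]
  simp [phase_single, smul_smul, cosMode, mul_comm]

/-! ### Parseval's identity, transported from the unit torus. -/

section Torus

local instance haarMeasureSpace : MeasureSpace UnitAddCircle := ⟨AddCircle.haarAddCircle⟩

/-- The parametrization of the box by the unit torus. -/
def torusMap (T : Fin p → ℝ) (x : UnitAddTorus (Fin p)) : E p :=
  WithLp.toLp 2 (Matrix.toLin' (Matrix.diagonal T)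
    (UnitAddTorus.measurableEquivPiIoc (0 : Fin p → ℝ) x).1)

theorem measurableEmbedding_torusMap (hT : ∀ α, 0 < T α) : MeasurableEmbedding (torusMap T) := by
  have h1 : MeasurableEmbedding fun x : Fin p → ℝ =>
      (WithLp.toLp 2 (Matrix.toLin' (Matrix.diagonal T) x) : E p) := by
    refine Measurable.measurableEmbedding ?_ ?_
    · refine (MeasurableEquiv.toLp 2 (Fin p → ℝ)).measurable.comp ?_
      exact (LinearMap.continuous_of_finiteDimensional _).measurable
    · intro x y hxy
      funext i
      have := congrArg (fun z : E p => z i) hxy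
      simpa [Matrix.mulVec_diagonal, (hT i).ne'] using this
  exact h1.comp ((MeasurableEmbedding.subtype_coe
    (MeasurableSet.univ_pi' fun i => measurableSet_Ioc)).comp
      (UnitAddTorus.measurableEquivPiIoc (0 : Fin p → ℝ)).measurableEmbedding)

/-- The torus carries normalized Haar measure, so the diagonal scaling produces Lebesgue measure
divided by the determinant. The half-open cube that parametrizes the torus differs from the closed
one by a null set. -/
theorem measurePreserving_torusMap (hT : ∀ α, 0 < T α) :
    ∃ C : ℝ≥0∞, C ≠ 0 ∧ C ≠ ⊤ ∧
      MeasurePreserving (torusMap T) volume (C • boxMeasure T) := by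
  have hdet : (Matrix.diagonal T).det ≠ 0 := by
    rw [Matrix.det_diagonal]
    exact Finset.prod_ne_zero_iff.2 fun i _ => (hT i).ne'
  set d := ENNReal.ofReal |(Matrix.diagonal T).det| with hd
  have hd0 : d ≠ 0 := by simpa [hd] using hdet
  have hdt : d ≠ ⊤ := ENNReal.ofReal_ne_top
  refine ⟨d⁻¹, ENNReal.inv_ne_zero.2 hdt, ENNReal.inv_ne_top.2 hd0, ?_⟩
  have h1 : MeasurePreserving (Matrix.toLin' (Matrix.diagonal T))
      (volume : Measure (Fin p → ℝ)) (d⁻¹ • volume) := by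
    refine ⟨(LinearMap.continuous_of_finiteDimensional _).measurable, ?_⟩
    conv_rhs => rw [← Real.smul_map_diagonal_volume_pi hdet]
    rw [smul_smul, ENNReal.inv_mul_cancel hd0 hdt, one_smul]
  have h2 := ((PiLp.volume_preserving_toLp (Fin p)).smul_measure d⁻¹).comp h1
  have h3 := h2.restrict_preimage (measurableSet_box (T := T))
  rw [Measure.restrict_smul] at h3
  have h4 : (volume : Measure (Fin p → ℝ)).restrict
      ((WithLp.toLp 2 ∘ Matrix.toLin' (Matrix.diagonal T)) ⁻¹' box T) =
      volume.restrict {x | ∀ i, x i ∈ Ioc ((0 : Fin p → ℝ) i) ((0 : Fin p → ℝ) i + 1)} := by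
    refine Measure.restrict_congr_set ?_
    have := Measure.univ_pi_Ioc_ae_eq_Icc (μ := fun _ : Fin p => (volume : Measure ℝ))
      (f := fun _ => 0) (g := fun _ => 1)
    have e1 : (WithLp.toLp 2 ∘ Matrix.toLin' (Matrix.diagonal T)) ⁻¹' box T =
        Icc (fun _ => 0) (fun _ => 1) := by
      ext x
      simp only [mem_preimage, Function.comp_apply, box, mem_ofPred_eq, mem_Icc, Pi.le_def,
        ← forall_and]
      refine forall_congr' fun i => ?_
      simp [Matrix.mulVec_diagonal, hT i]
    have e2 : {x | ∀ i, x i ∈ Ioc ((0 : Fin p → ℝ) i) ((0 : Fin p → ℝ) i + 1)} =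
        univ.pi fun _ => Ioc 0 1 := by
      ext x
      simp
    rw [e1, e2]
    exact this.symm
  rw [h4] at h3
  exact h3.comp ((measurePreserving_subtype_coe
    (MeasurableSet.univ_pi' fun i => measurableSet_Ioc)).comp
      (UnitAddTorus.measurePreserving_equivPiIoc (0 : Fin p → ℝ)))

theorem mFourier_eq (hT : ∀ α, 0 < T α) (k : Fin p → ℤ) (x : UnitAddTorus (Fin p)) :
    UnitAddTorus.mFourier k x = Complex.exp ((phase T k (torusMap T x) : ℝ) * Complex.I) := by
  have h : ∀ i, x i = (((UnitAddTorus.measurableEquivPiIoc (0 : Fin p → ℝ) x).1 i : ℝ) :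
      UnitAddCircle) := fun i => AddCircle.coe_equivIoc.symm
  simp only [UnitAddTorus.mFourier, ContinuousMap.coe_mk]
  rw [phase_apply, Complex.ofReal_sum, Finset.sum_mul, Complex.exp_sum]
  refine Finset.prod_congr rfl fun i _ => ?_
  rw [h i, fourier_coe_apply]
  congr 1
  have : (T i : ℂ) ≠ 0 := by exact_mod_cast (hT i).ne'
  simp only [torusMap, freq, Matrix.toLin'_apply, Matrix.mulVec_diagonal]
  push_cast
  field_simp

/-- Parseval's identity on the box for the real Fourier modes. -/
theorem hasSum_fourier (hT : ∀ α, 0 < T α) :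
    ∃ V : ℝ, 0 < V ∧ ∀ u v : L2Box T n, HasSum (fun k : Fin p → ℤ => ∑ j,
      (inner ℝ u (testL2 (cosMode T k j)) * inner ℝ v (testL2 (cosMode T k j)) +
        inner ℝ u (testL2 (sinMode T k j)) * inner ℝ v (testL2 (sinMode T k j))))
      (V * inner ℝ u v) := by
  obtain ⟨C, hC0, hCt, hmp⟩ := measurePreserving_torusMap hT
  have hc : 0 < C.toReal := ENNReal.toReal_pos hC0 hCt
  have hint : ∀ g : E p → ℂ, ∫ x, g (torusMap T x) = C.toReal • ∫ t, g t ∂(boxMeasure T) :=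
    fun g => by rw [hmp.integral_comp (measurableEmbedding_torusMap hT), integral_smul_measure]
  have hcomp : ∀ (u : L2Box T n) (j : Fin n),
      MemLp (fun t => ((u t j : ℝ) : ℂ)) 2 (boxMeasure T) := fun u j =>
    (Complex.ofRealCLM.comp (EuclideanSpace.proj j)).comp_memLp' (Lp.memLp u)
  have hmem : ∀ (u : L2Box T n) (j : Fin n),
      MemLp (fun x => ((u (torusMap T x) j : ℝ) : ℂ)) 2
        (volume : Measure (UnitAddTorus (Fin p))) := fun u j =>
    MemLp.comp_measurePreserving ((hcomp u j).smul_measure hCt) hmp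
  -- Since `u` is real, its pairings with the cosine and sine modes are, up to sign and the factor
  -- `C`, the real and imaginary parts of a complex Fourier coefficient.
  have hcoef : ∀ (u : L2Box T n) (j : Fin n) (k : Fin p → ℤ),
      UnitAddTorus.mFourierCoeff ((hmem u j).toLp _) k =
        C.toReal • (((inner ℝ u (testL2 (cosMode T k j)) : ℝ) : ℂ) -
          ((inner ℝ u (testL2 (sinMode T k j)) : ℝ) : ℂ) * Complex.I) := by
    intro u j k
    have e1 : UnitAddTorus.mFourierCoeff ((hmem u j).toLp _) k =
        ∫ x, (fun t => (((inner ℝ (u t) ((cosMode T k j).1 t) : ℝ) : ℂ) -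
          ((inner ℝ (u t) ((sinMode T k j).1 t) : ℝ) : ℂ) * Complex.I)) (torusMap T x) := by
      refine integral_congr_ae ?_
      filter_upwards [(hmem u j).coeFn_toLp] with x hx
      rw [hx, UnitAddTorus.mFourier_neg, mFourier_eq hT, ← Complex.exp_conj]
      simp only [cosMode, sinMode, map_mul, Complex.conj_ofReal, Complex.conj_I, mul_neg,
        real_inner_smul_right, EuclideanSpace.inner_single_right, smul_eq_mul]
      rw [← neg_mul, ← Complex.ofReal_neg, Complex.exp_mul_I, ← Complex.ofReal_cos,
        ← Complex.ofReal_sin, Real.cos_neg, Real.sin_neg]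
      simp
      ring
    have i1 := (integrable_inner_continuous T u (isTest (cosMode T k j)).smooth.continuous)
    have i2 := (integrable_inner_continuous T u (isTest (sinMode T k j)).smooth.continuous)
    rw [e1]
    have hh := hint (fun t => (((inner ℝ (u t) ((cosMode T k j).1 t) : ℝ) : ℂ) -
          ((inner ℝ (u t) ((sinMode T k j).1 t) : ℝ) : ℂ) * Complex.I))
    convert hh using 1
    rw [inner_testL2, inner_testL2, integral_sub i1.ofReal (i2.ofReal.mul_const _),
      integral_mul_const, integral_complex_ofReal, integral_complex_ofReal]
  -- Products of two coefficients carry `C²`, the integral of `u v` over the torus carries `C`; the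
  -- quotient leaves `1 / C`.
  refine ⟨C.toReal⁻¹, inv_pos.2 hc, fun u v => ?_⟩
  have hj : ∀ j : Fin n, HasSum (fun k : Fin p → ℤ => C.toReal ^ 2 *
      (inner ℝ u (testL2 (cosMode T k j)) * inner ℝ v (testL2 (cosMode T k j)) +
        inner ℝ u (testL2 (sinMode T k j)) * inner ℝ v (testL2 (sinMode T k j))))
      (C.toReal * ∫ t, u t j * v t j ∂(boxMeasure T)) := by
    intro j
    have h := UnitAddTorus.hasSum_prod_mFourierCoeff ((hmem u j).toLp _) ((hmem v j).toLp _)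
    have h' := Complex.hasSum_re h
    have hr : ∫ x, (starRingEnd ℂ) ((hmem u j).toLp _ x) * (hmem v j).toLp _ x =
        ((C.toReal * ∫ t, u t j * v t j ∂(boxMeasure T) : ℝ) : ℂ) := by
      rw [Complex.ofReal_mul, ← integral_complex_ofReal, ← Complex.real_smul, ← hint]
      refine integral_congr_ae ?_
      filter_upwards [(hmem u j).coeFn_toLp, (hmem v j).coeFn_toLp] with x hx hy
      rw [hx, hy]
      simp
    rw [hr, Complex.ofReal_re] at h'
    refine h'.congr_fun fun k => ?_
    rw [hcoef, hcoef]
    simp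
    ring
  have hs := hasSum_sum fun j (_ : j ∈ Finset.univ) => hj j
  have hinner : ∑ j, ∫ t, u t j * v t j ∂(boxMeasure T) = inner ℝ u v := by
    rw [L2.inner_def, ← integral_finsetSum]
    · simp [PiLp.inner_apply, mul_comm]
    · intro j _
      have m1 : ∀ w : L2Box T n, MemLp (fun t => w t j) 2 (boxMeasure T) := fun w =>
        (EuclideanSpace.proj (𝕜 := ℝ) j).comp_memLp' (Lp.memLp w)
      exact (m1 u).integrable_mul (m1 v)
  rw [← Finset.mul_sum, hinner] at hs
  have := hs.mul_left (C.toReal ^ 2)⁻¹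
  rw [show (C.toReal ^ 2)⁻¹ * (C.toReal * inner ℝ u v) = C.toReal⁻¹ * inner ℝ u v by
    field_simp] at this
  refine this.congr_fun fun k => ?_
  rw [← Finset.mul_sum, inv_mul_cancel_left₀ (by positivity)]

end Torus

/-! ### Completeness, density of test functions, Poincaré–Wirtinger. -/

theorem IsWeakPartialDeriv.inner_cosMode {α : Fin p} {u v : L2Box T n}
    (h : IsWeakPartialDeriv T α u v) (k : Fin p → ℤ) (j : Fin n) :
    inner ℝ v (testL2 (cosMode T k j)) = freq T k α * inner ℝ u (testL2 (sinMode T k j)) := by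
  have := isWeakPartialDeriv_iff.1 h (cosMode T k j)
  rw [testDeriv_cosMode, real_inner_smul_right] at this
  linarith

theorem IsWeakPartialDeriv.inner_sinMode {α : Fin p} {u v : L2Box T n}
    (h : IsWeakPartialDeriv T α u v) (k : Fin p → ℤ) (j : Fin n) :
    inner ℝ v (testL2 (sinMode T k j)) = -(freq T k α * inner ℝ u (testL2 (cosMode T k j))) := by
  have := isWeakPartialDeriv_iff.1 h (sinMode T k j)
  rw [testDeriv_sinMode, real_inner_smul_right] at this
  linarith

/-- The real Fourier modes form a complete system. -/
theorem eq_zero_of_fourier (hT : ∀ α, 0 < T α) {u : L2Box T n}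
    (hc : ∀ k j, inner ℝ u (testL2 (cosMode T k j)) = 0)
    (hs : ∀ k j, inner ℝ u (testL2 (sinMode T k j)) = 0) : u = 0 := by
  obtain ⟨V, hV, h⟩ := hasSum_fourier (n := n) hT
  have h1 := h u u
  simp only [hc, hs, mul_zero, add_zero, Finset.sum_const_zero] at h1
  have h2 := h1.unique hasSum_zero
  rw [mul_eq_zero, or_iff_right hV.ne'] at h2
  exact inner_self_eq_zero.1 h2

theorem isClosed_H1T : IsClosed (H1T T n : Set (WithLp 2 (L2Box T n × PiLp 2 fun _ : Fin p =>
    L2Box T n))) := by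
  have : (H1T T n : Set (WithLp 2 (L2Box T n × PiLp 2 fun _ : Fin p => L2Box T n))) =
      ⋂ (α : Fin p) (f : testFunctions T n),
        {w | inner ℝ w.fst (testDeriv α f) = -inner ℝ (w.snd α) (testL2 f)} := by
    ext w
    simp only [mem_iInter]
    exact forall_congr' fun α => isWeakPartialDeriv_iff
  rw [this]
  refine isClosed_iInter fun α => isClosed_iInter fun f => isClosed_eq ?_ ?_
  · exact (WithLp.prod_continuous_ofLp 2 _ _).fst.inner continuous_const
  · have : Continuous fun w : WithLp 2 (L2Box T n × PiLp 2 fun _ : Fin p => L2Box T n) =>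
        w.snd α :=
      (PiLp.continuous_apply 2 _ α).comp (WithLp.prod_continuous_ofLp 2 _ _).snd
    exact (this.inner continuous_const).neg

instance completeSpace_H1T : @CompleteSpace (H1T T n)
    (inferInstance : NormedAddCommGroup (H1T T n)).toMetricSpace.toPseudoMetricSpace.toUniformSpace :=
  isClosed_H1T.completeSpace_coe

theorem H1T_ext {u v : H1T T n} (h : toL2 u = toL2 v) (h' : ∀ α, wderiv u α = wderiv v α) :
    u = v := by
  have : u - v = 0 := by
    rw [← norm_eq_zero, ← sq_eq_zero_iff, H1T_norm_sq]
    simp [h, h']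
  exact sub_eq_zero.1 this

/-- In a Hilbert space a subspace with trivial orthogonal complement is dense. -/
theorem exists_norm_sub_lt_of_orthogonal {X H : Type*} [AddCommGroup X] [Module ℝ X]
    [NormedAddCommGroup H] [InnerProductSpace ℝ H] [CompleteSpace H] (A : X →ₗ[ℝ] H)
    (h : ∀ w, (∀ x, inner ℝ (A x) w = 0) → w = 0) (w : H) {ε : ℝ} (hε : 0 < ε) :
    ∃ x, ‖w - A x‖ < ε := by
  have key : (LinearMap.range A).topologicalClosure = ⊤ := by
    rw [Submodule.topologicalClosure_eq_top_iff, Submodule.eq_bot_iff]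
    exact fun w hw => h w fun x => (Submodule.mem_orthogonal _ w).1 hw (A x) ⟨x, rfl⟩
  have h2 := Submodule.dense_iff_topologicalClosure_eq_top.2 key
  rw [LinearMap.coe_range] at h2
  obtain ⟨x, hx⟩ := DenseRange.exists_dist_lt h2 w hε
  exact ⟨x, by rwa [← dist_eq_norm]⟩

/-- Smooth periodic functions are dense in `H¹_T`. -/
theorem exists_norm_sub_testH1_lt (hT : ∀ α, 0 < T α) (u : H1T T n) {ε : ℝ} (hε : 0 < ε) :
    ∃ f : testFunctions T n, ‖u - testH1 hT f‖ < ε := by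
  suffices key : ∀ w : H1T T n, (∀ f : testFunctions T n, inner ℝ (testH1 hT f) w = 0) → w = 0 by
    have h := exists_norm_sub_lt_of_orthogonal (H := H1T T n) (testH1 hT)
    exact h key u hε
  intro w hw
  have h : ∀ f, inner ℝ (toL2 w) (testL2 f) +
      ∑ α, inner ℝ (wderiv w α) (testDeriv α f) = 0 := fun f => by
    have := hw f
    rw [real_inner_comm, H1T_inner] at this
    exact this
  have hd := isWeakPartialDeriv_wderiv w
  -- Orthogonality to a mode of frequency `ω` says that `1 + |ω|²` times the corresponding
  -- coefficient of `w` vanishes.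
  have pos : ∀ k, 0 < 1 + ∑ α, freq T k α ^ 2 := fun k =>
    add_pos_of_pos_of_nonneg one_pos (Finset.sum_nonneg fun α _ => sq_nonneg _)
  have hc : ∀ k j, inner ℝ (toL2 w) (testL2 (cosMode T k j)) = 0 := fun k j => by
    have := h (cosMode T k j)
    simp only [testDeriv_cosMode, real_inner_smul_right, (hd _).inner_sinMode, neg_mul_neg,
      ← mul_assoc, ← sq, ← Finset.sum_mul] at this
    exact (mul_eq_zero.1 (by linarith : (1 + ∑ α, freq T k α ^ 2) *
      inner ℝ (toL2 w) (testL2 (cosMode T k j)) = 0)).resolve_left (pos k).ne'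
  have hs : ∀ k j, inner ℝ (toL2 w) (testL2 (sinMode T k j)) = 0 := fun k j => by
    have := h (sinMode T k j)
    simp only [testDeriv_sinMode, real_inner_smul_right, (hd _).inner_cosMode,
      ← mul_assoc, ← sq, ← Finset.sum_mul] at this
    exact (mul_eq_zero.1 (by linarith : (1 + ∑ α, freq T k α ^ 2) *
      inner ℝ (toL2 w) (testL2 (sinMode T k j)) = 0)).resolve_left (pos k).ne'
  refine H1T_ext (eq_zero_of_fourier hT hc hs) fun α => eq_zero_of_fourier hT ?_ ?_
  · intro k j
    rw [(hd α).inner_cosMode, hs, mul_zero]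
  · intro k j
    rw [(hd α).inner_sinMode, hc, mul_zero, neg_zero]

theorem cosMode_zero (j : Fin n) (t : E p) :
    (cosMode T 0 j).1 t = EuclideanSpace.single j 1 := by
  simp [cosMode, phase_apply, freq]

theorem sinMode_zero (j : Fin n) : sinMode T 0 j = 0 := by
  ext1
  funext t
  simp [sinMode, phase_apply, freq]

/-- The Poincaré–Wirtinger inequality. -/
theorem poincare_wirtinger (hT : ∀ α, 0 < T α) :
    ∃ V K : ℝ, 0 < V ∧ 0 ≤ K ∧ ∀ u : H1T T n, V * ‖toL2 u‖ ^ 2 ≤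
      ∑ j, inner ℝ (toL2 u) (testL2 (cosMode T 0 j)) ^ 2 + K * ∑ α, ‖wderiv u α‖ ^ 2 := by
  obtain ⟨V, hV, h⟩ := hasSum_fourier (n := n) hT
  -- After Parseval the claim is a termwise comparison: the mode `k = 0` is kept as it is, and for
  -- `k ≠ 0` the factor `∑ T α ^ 2` makes the squared frequency at least `1`.
  refine ⟨V, (∑ α, T α ^ 2) * V, hV,
    mul_nonneg (Finset.sum_nonneg fun α _ => sq_nonneg _) hV.le, fun u => ?_⟩
  set A : (Fin p → ℤ) → ℝ := fun k => ∑ j, (inner ℝ (toL2 u) (testL2 (cosMode T k j)) ^ 2 +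
    inner ℝ (toL2 u) (testL2 (sinMode T k j)) ^ 2) with hA
  have hA0 : ∀ k, 0 ≤ A k := fun k => Finset.sum_nonneg fun j _ => by positivity
  have h1 : HasSum A (V * ‖toL2 u‖ ^ 2) := by
    rw [← real_inner_self_eq_norm_sq]
    refine (h (toL2 u) (toL2 u)).congr_fun fun k => ?_
    simp only [hA, sq]
  have h2 : ∀ α, HasSum (fun k => freq T k α ^ 2 * A k) (V * ‖wderiv u α‖ ^ 2) := fun α => by
    rw [← real_inner_self_eq_norm_sq]
    refine (h (wderiv u α) (wderiv u α)).congr_fun fun k => ?_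
    simp only [hA, Finset.mul_sum, (isWeakPartialDeriv_wderiv u α).inner_cosMode,
      (isWeakPartialDeriv_wderiv u α).inner_sinMode]
    refine Finset.sum_congr rfl fun j _ => ?_
    ring
  have h3 := (hasSum_sum fun α (_ : α ∈ Finset.univ) => h2 α).mul_left (∑ α, T α ^ 2)
  have h4 : HasSum (fun k : Fin p → ℤ => if k = 0 then A 0 else 0) (A 0) := hasSum_ite_eq (0 : Fin p → ℤ) (A 0)
  have h45 : HasSum (fun k => (if k = 0 then A 0 else 0) +
      (∑ α, T α ^ 2) * ∑ α, freq T k α ^ 2 * A k)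
      (A 0 + (∑ α, T α ^ 2) * ∑ α, V * ‖wderiv u α‖ ^ 2) := h4.add h3
  have h5 := hasSum_le (fun k => ?_) h1 h45
  · refine h5.trans (le_of_eq ?_)
    rw [← Finset.mul_sum, mul_assoc]
    simp [hA, sinMode_zero]
  · by_cases hk : k = 0
    · simp only [hk, if_true]
      refine le_add_of_nonneg_right (mul_nonneg (Finset.sum_nonneg fun α _ => sq_nonneg _)
        (Finset.sum_nonneg fun α _ => mul_nonneg (sq_nonneg _) (hA0 _)))
    · simp only [hk, if_false, zero_add]
      obtain ⟨α, hα⟩ := Function.ne_iff.1 hk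
      -- A nonzero integer has square at least `1`, and `T α * freq T k α = 2π k α`.
      have hα' : (1 : ℝ) ≤ (k α : ℝ) ^ 2 := by
        exact_mod_cast Int.one_le_abs (pow_ne_zero 2 hα) |>.trans_eq (abs_of_nonneg (sq_nonneg _))
      have hone : 1 ≤ T α ^ 2 * freq T k α ^ 2 := by
        have : T α ^ 2 * freq T k α ^ 2 = (2 * Real.pi) ^ 2 * (k α : ℝ) ^ 2 := by
          have := (hT α).ne'
          rw [freq]
          field_simp
        rw [this]
        have hpi : 1 ≤ (2 * Real.pi) ^ 2 := one_le_pow₀ (by linarith [Real.pi_gt_three])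
        exact one_le_mul_of_one_le_of_one_le hpi hα'
      have hle : T α ^ 2 * freq T k α ^ 2 ≤ (∑ α, T α ^ 2) * ∑ α, freq T k α ^ 2 :=
        mul_le_mul (Finset.single_le_sum (f := fun α => T α ^ 2) (fun _ _ => sq_nonneg _)
          (Finset.mem_univ α))
          (Finset.single_le_sum (f := fun α => freq T k α ^ 2) (fun _ _ => sq_nonneg _)
          (Finset.mem_univ α)) (sq_nonneg _) (Finset.sum_nonneg fun _ _ => sq_nonneg _)
      rw [← Finset.sum_mul, ← mul_assoc]
      exact le_mul_of_one_le_left (hA0 k) (hone.trans hle)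

/-! ### Elliptic regularity: second derivatives controlled by the Laplacian. -/

/-- A linear functional bounded by the norm of a linear map into a Hilbert space factors through
the inner product with a vector. -/
theorem exists_inner_eq_of_bound {X H : Type*} [AddCommGroup X] [Module ℝ X]
    [NormedAddCommGroup H] [InnerProductSpace ℝ H] [CompleteSpace H] (A : X →ₗ[ℝ] H)
    (l : X →ₗ[ℝ] ℝ) (C : ℝ) (hC : ∀ x, |l x| ≤ C * ‖A x‖) : ∃ v : H, ∀ x, l x = inner ℝ v (A x) := by
  -- The choice of the section `s` is immaterial: `hC` forces `l` to vanish on the kernel of `A`.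
  obtain ⟨s, hs⟩ := A.rangeRestrict.exists_rightInverse_of_surjective A.range_rangeRestrict
  have hs' : ∀ y, A (s y) = y := fun y => congrArg Subtype.val (LinearMap.congr_fun hs y)
  let g : LinearMap.range A →L[ℝ] ℝ := (l.comp s).mkContinuous C fun y => by
    simpa [hs'] using hC (s y)
  obtain ⟨G, hG, -⟩ := exists_extension_norm_eq _ g
  refine ⟨(InnerProductSpace.toDual ℝ H).symm G, fun x => ?_⟩
  rw [InnerProductSpace.toDual_symm_apply]
  have h1 := hG ⟨A x, x, rfl⟩
  change G (A x) = l (s ⟨A x, x, rfl⟩) at h1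
  rw [h1, ← sub_eq_zero, ← map_sub, ← abs_eq_zero]
  refine le_antisymm ((hC _).trans (le_of_eq ?_)) (abs_nonneg _)
  rw [map_sub, hs', sub_self, norm_zero, mul_zero]

/-- If `x`, `y` are coefficients of `u`, `f` on a mode of frequency `ω`, that mode contributes `ω_α
ω_β x y` to the pairing, while `w` has coefficient `-|ω|² x`. As `|ω_α ω_β| ≤ |ω|²`, the bound
follows from Parseval. It makes the pairing an `L²`-bounded functional of `f`, whose representing
vector is, up to sign, a second derivative of `u`. -/
theorem abs_inner_wderiv_testDeriv_le (hT : ∀ α, 0 < T α) {u : H1T T n} {w : L2Box T n}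
    (hw : IsWeakLaplacian T u w) (α β : Fin p) (f : testFunctions T n) :
    |inner ℝ (wderiv u α) (testDeriv β f)| ≤ ‖w‖ * ‖testL2 f‖ := by
  obtain ⟨V, hV, h⟩ := hasSum_fourier (n := n) hT
  have hu := isWeakPartialDeriv_wderiv u
  rw [isWeakLaplacian_iff] at hw
  have hc : ∀ k j, inner ℝ w (testL2 (cosMode T k j)) =
      -((∑ γ, freq T k γ ^ 2) * inner ℝ (toL2 u) (testL2 (cosMode T k j))) := fun k j => by
    have := hw (cosMode T k j)
    simp only [testDeriv_cosMode, real_inner_smul_right, (hu _).inner_sinMode, neg_mul_neg,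
        ← mul_assoc, ← sq, ← Finset.sum_mul] at this
    linarith
  have hs : ∀ k j, inner ℝ w (testL2 (sinMode T k j)) =
      -((∑ γ, freq T k γ ^ 2) * inner ℝ (toL2 u) (testL2 (sinMode T k j))) := fun k j => by
    have := hw (sinMode T k j)
    simp only [testDeriv_sinMode, real_inner_smul_right, (hu _).inner_cosMode,
        ← mul_assoc, ← sq, ← Finset.sum_mul] at this
    linarith
  have hfreq : ∀ k, |freq T k α * freq T k β| ≤ ∑ γ, freq T k γ ^ 2 := fun k => by
    have ha := Finset.single_le_sum (f := fun γ => freq T k γ ^ 2) (fun _ _ => sq_nonneg _)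
      (Finset.mem_univ α)
    have hb := Finset.single_le_sum (f := fun γ => freq T k γ ^ 2) (fun _ _ => sq_nonneg _)
      (Finset.mem_univ β)
    rw [abs_le]
    constructor <;> nlinarith [sq_nonneg (freq T k α + freq T k β),
      sq_nonneg (freq T k α - freq T k β)]
  have hterm : ∀ (k : Fin p → ℤ) (x y : ℝ), 2 * (freq T k α * freq T k β * x * y) ≤
      ((∑ γ, freq T k γ ^ 2) * x) ^ 2 + y ^ 2 := fun k x y => by
    have h1 : (freq T k α * freq T k β) ^ 2 ≤ (∑ γ, freq T k γ ^ 2) ^ 2 :=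
      sq_le_sq' (by linarith [abs_le.1 (hfreq k)]) (abs_le.1 (hfreq k)).2
    nlinarith [sq_nonneg (freq T k α * freq T k β * x - y), mul_le_mul_of_nonneg_right h1
      (sq_nonneg x)]
  have amgm : ∀ g : testFunctions T n,
      2 * inner ℝ (wderiv u α) (testDeriv β g) ≤ ‖w‖ ^ 2 + ‖testL2 g‖ ^ 2 := fun g => by
    have hg := isWeakPartialDeriv_test hT β g
    have h1 := (h (wderiv u α) (testDeriv β g)).mul_left 2
    have h2 := (h w w).add (h (testL2 g) (testL2 g))
    have h3 := hasSum_le (fun k => ?_) h1 h2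
    · rw [real_inner_self_eq_norm_sq, real_inner_self_eq_norm_sq] at h3
      refine le_of_mul_le_mul_left ?_ hV
      linarith
    · rw [← Finset.sum_add_distrib, Finset.mul_sum]
      refine Finset.sum_le_sum fun j _ => ?_
      rw [(hu α).inner_cosMode, (hu α).inner_sinMode, hg.inner_cosMode, hg.inner_sinMode, hc, hs]
      have e1 := hterm k (inner ℝ (toL2 u) (testL2 (cosMode T k j)))
        (inner ℝ (testL2 g) (testL2 (cosMode T k j)))
      have e2 := hterm k (inner ℝ (toL2 u) (testL2 (sinMode T k j)))
        (inner ℝ (testL2 g) (testL2 (sinMode T k j)))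
      linarith
  -- Applied to `r • f`, `amgm` makes a quadratic polynomial in `r` nonnegative; its discriminant
  -- turns the sum of squares into a product of norms.
  have hdisc := discrim_le_zero (a := ‖testL2 f‖ ^ 2)
    (b := -(2 * inner ℝ (wderiv u α) (testDeriv β f))) (c := ‖w‖ ^ 2) fun r => by
      have := amgm (r • f)
      rw [map_smul, map_smul, real_inner_smul_right, norm_smul, mul_pow, Real.norm_eq_abs,
        sq_abs] at this
      linarith
  refine abs_le_of_sq_le_sq ?_ (by positivity)
  rw [discrim] at hdisc
  nlinarith

/-- The weak derivatives of a function with square integrable weak Laplacian are in `H¹_T`. -/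
theorem exists_toL2_eq_wderiv (hT : ∀ α, 0 < T α) {u : H1T T n} {w : L2Box T n}
    (hw : IsWeakLaplacian T u w) (α : Fin p) : ∃ z : H1T T n, toL2 z = wderiv u α := by
  have : ∀ β, ∃ v : L2Box T n, IsWeakPartialDeriv T β (wderiv u α) v := fun β => by
    obtain ⟨v, hv⟩ := exists_inner_eq_of_bound testL2
      ((innerSL ℝ (wderiv u α)).toLinearMap.comp (testDeriv β)) ‖w‖ fun f =>
        abs_inner_wderiv_testDeriv_le hT hw α β f
    refine ⟨-v, isWeakPartialDeriv_iff.2 fun f => ?_⟩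
    rw [inner_neg_left, neg_neg]
    exact hv f
  choose v hv using this
  exact ⟨⟨WithLp.toLp 2 (wderiv u α, WithLp.toLp 2 v), hv⟩, rfl⟩

/-! ### Traces on the faces. -/

theorem measurePreserving_toLp_boxMeasure :
    MeasurePreserving (WithLp.toLp 2)
      (Measure.pi fun α => volume.restrict (Icc 0 (T α))) (boxMeasure T) := by
  have h := (PiLp.volume_preserving_toLp (Fin p)).restrict_preimage (measurableSet_box (T := T))
  have e : (WithLp.toLp 2 : (Fin p → ℝ) → E p) ⁻¹' box T = univ.pi fun α => Icc 0 (T α) := by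
    ext x
    simp [box, Pi.le_def, forall_and]
  rw [e, volume_pi, Measure.restrict_pi_pi] at h
  exact h

theorem faceProj_eq (i : Fin p) (c : ℝ) (t : E p) :
    faceProj i c t = faceProj i 0 t + c • EuclideanSpace.single i (1 : ℝ) := by
  ext j
  by_cases h : j = i
  · subst h
    simp [faceProj]
  · simp [faceProj, h]

theorem faceProj_self (i : Fin p) (t : E p) : faceProj i (t i) t = t := by
  simp [faceProj]

theorem faceProj_faceProj (i : Fin p) (c d : ℝ) (t : E p) :
    faceProj i c (faceProj i d t) = faceProj i c t := by
  simp [faceProj]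

theorem continuous_faceProj (i : Fin p) (c : ℝ) : Continuous (faceProj i c : E p → E p) :=
  (PiLp.continuous_toLp 2 _).comp
    ((PiLp.continuous_ofLp 2 _).update i continuous_const)

/-- Fubini's theorem for a slab of the box: a function averaged along the `i`-th axis. -/
theorem setLIntegral_slab (i : Fin p) {A : Set ℝ} (hA : MeasurableSet A) {φ : E p → ℝ≥0∞}
    (hφ : Measurable φ) :
    ∫⁻ t in {t : E p | t i ∈ A}, (∫⁻ r in Icc 0 (T i), φ (faceProj i r t)) ∂(boxMeasure T) =
      volume.restrict (Icc 0 (T i)) A * ∫⁻ t, φ t ∂(boxMeasure T) := by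
  set μ : Fin p → Measure ℝ := fun α => volume.restrict (Icc 0 (T α)) with hμ
  set ψ : (Fin p → ℝ) → ℝ≥0∞ := fun x => φ (WithLp.toLp 2 x) with hψ
  have hm : Measurable ψ := hφ.comp (MeasurableEquiv.toLp 2 (Fin p → ℝ)).measurable
  have hemb : MeasurableEmbedding (WithLp.toLp 2 : (Fin p → ℝ) → E p) :=
    (MeasurableEquiv.toLp 2 (Fin p → ℝ)).measurableEmbedding
  have hS : MeasurableSet {t : E p | t i ∈ A} :=
    hA.preimage ((measurable_pi_apply i).comp
      (MeasurableEquiv.toLp 2 (Fin p → ℝ)).symm.measurable)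
  have h1 : ∀ x, ∫⁻ r in Icc 0 (T i), φ (faceProj i r (WithLp.toLp 2 x)) =
      (∫⋯∫⁻_{i}, ψ ∂μ) x := fun x => by
    rw [lmarginal_singleton]
    rfl
  rw [← lintegral_indicator hS,
    ← measurePreserving_toLp_boxMeasure.lintegral_comp_emb hemb,
    ← measurePreserving_toLp_boxMeasure.lintegral_comp_emb hemb,
    ← lintegral_const_mul _ hm]
  have hmG : Measurable (∫⋯∫⁻_{i}, ψ ∂μ) := hm.lmarginal μ
  have e : ∀ x, ({t : E p | t i ∈ A}.indicator
      (fun t => ∫⁻ r in Icc 0 (T i), φ (faceProj i r t))) (WithLp.toLp 2 x) =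
      A.indicator 1 (x i) * (∫⋯∫⁻_{i}, ψ ∂μ) x := fun x => by
    rw [← h1]
    by_cases h : x i ∈ A <;> simp [h]
  simp only [e]
  have hmA : Measurable fun x : Fin p → ℝ => A.indicator (1 : ℝ → ℝ≥0∞) (x i) :=
    (measurable_one.indicator hA).comp (measurable_pi_apply i)
  -- It suffices to compare after integrating out the `i`-th coordinate. The inner integral does not
  -- depend on it, so only the measure of `A` is left.
  refine lintegral_eq_of_lmarginal_eq (μ := μ) {i} (hmA.mul hmG) (hm.const_mul _) ?_
  funext x
  have e2 : ∀ r, (∫⋯∫⁻_{i}, ψ ∂μ) (Function.update x i r) = (∫⋯∫⁻_{i}, ψ ∂μ) x := fun r =>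
    lmarginal_update_of_mem μ (Finset.mem_singleton_self i) ψ x r
  have e3 : (∫⋯∫⁻_{i}, fun a => volume.restrict (Icc 0 (T i)) A * ψ a ∂μ) x =
      volume.restrict (Icc 0 (T i)) A * (∫⋯∫⁻_{i}, ψ ∂μ) x := by
    rw [lmarginal_singleton, lmarginal_singleton]
    exact lintegral_const_mul _ (hm.comp (measurable_update x))
  rw [e3]
  clear e hmG h1 e3
  generalize (∫⋯∫⁻_{i}, ψ ∂μ) = Φ at e2 ⊢
  rw [lmarginal_singleton]
  simp only [e2, Function.update_self]
  rw [lintegral_mul_const _ (measurable_one.indicator hA), lintegral_indicator_one hA]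

theorem sq_setLIntegral_le {μ : Measure ℝ} (s : Set ℝ) {g : ℝ → ℝ≥0∞} (hg : Measurable g) :
    (∫⁻ r in s, g r ∂μ) ^ 2 ≤ μ s * ∫⁻ r in s, g r ^ 2 ∂μ := by
  have h := ENNReal.lintegral_mul_le_Lp_mul_Lq (μ.restrict s) Real.HolderConjugate.two_two
    (f := fun _ => 1) (g := g) aemeasurable_const hg.aemeasurable
  simp only [Pi.mul_apply, one_mul, ENNReal.rpow_two, one_pow, lintegral_const, Measure.restrict_apply_univ] at h
  calc (∫⁻ r in s, g r ∂μ) ^ 2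
      ≤ (μ s ^ (1 / 2 : ℝ) * (∫⁻ r in s, g r ^ 2 ∂μ) ^ (1 / 2 : ℝ)) ^ 2 := by gcongr
    _ = μ s * ∫⁻ r in s, g r ^ 2 ∂μ := by
        rw [mul_pow, ← ENNReal.rpow_natCast, ← ENNReal.rpow_natCast, ← ENNReal.rpow_mul,
          ← ENNReal.rpow_mul]
        norm_num

/-- Fundamental theorem of calculus along the `i`-th axis, then Cauchy–Schwarz on the segment
between `c` and `t i`. The integral is enlarged to the whole edge so that it no longer depends on `t
i` and Fubini applies. -/
theorem enorm_sub_faceProj_sq_le (f : testFunctions T n) (i : Fin p) {c : ℝ}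
    (hc : c ∈ Icc 0 (T i)) {t : E p} (ht : t ∈ box T) :
    ‖f.1 t - f.1 (faceProj i c t)‖ₑ ^ 2 ≤ ENNReal.ofReal |t i - c| *
      ∫⁻ r in Icc 0 (T i), ‖partialDeriv i f.1 (faceProj i r t)‖ₑ ^ 2 := by
  have hline : ∀ r, HasDerivAt (fun r => faceProj i r t) (EuclideanSpace.single i (1 : ℝ)) r :=
    fun r => by
      have : (fun r => faceProj i r t) =
          fun r : ℝ => faceProj i 0 t + r • EuclideanSpace.single i (1 : ℝ) := by
        funext r
        exact faceProj_eq i r t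
      rw [this]
      simpa using ((hasDerivAt_id r).smul_const (EuclideanSpace.single i (1 : ℝ))).const_add
        (faceProj i 0 t)
  have hd : ∀ r, HasDerivAt (fun r => f.1 (faceProj i r t))
      (partialDeriv i f.1 (faceProj i r t)) r := fun r =>
    (differentiable_test f _).hasFDerivAt.comp_hasDerivAt r (hline r)
  have hcont : Continuous fun r => partialDeriv i f.1 (faceProj i r t) :=
    ((isTest f).continuous_partialDeriv i).comp
      (continuous_iff_continuousAt.2 fun r => (hline r).continuousAt)
  have hftc := intervalIntegral.integral_eq_sub_of_hasDerivAt (a := c) (b := t i)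
    (fun r _ => hd r) (hcont.intervalIntegrable _ _)
  rw [faceProj_self] at hftc
  have hsub : uIoc c (t i) ⊆ Icc 0 (T i) :=
    uIoc_subset_uIcc.trans ((convex_Icc 0 (T i)).ordConnected.uIcc_subset hc (ht i))
  rw [← hftc]
  calc ‖∫ r in c..t i, partialDeriv i f.1 (faceProj i r t)‖ₑ ^ 2
      ≤ (∫⁻ r in uIoc c (t i), ‖partialDeriv i f.1 (faceProj i r t)‖ₑ) ^ 2 := by
        gcongr
        rw [← ofReal_norm, intervalIntegral.norm_intervalIntegral_eq, ofReal_norm]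
        exact enorm_integral_le_lintegral_enorm _
    _ ≤ volume (uIoc c (t i)) *
          ∫⁻ r in uIoc c (t i), ‖partialDeriv i f.1 (faceProj i r t)‖ₑ ^ 2 :=
        sq_setLIntegral_le _ hcont.measurable.enorm
    _ ≤ _ := by
        rw [Real.volume_uIoc]
        gcongr

/-- The squared distance in a layer between a test function and its values on a hyperplane. -/
theorem setLIntegral_layer_le (f : testFunctions T n) (i : Fin p) {c : ℝ}
    (hc : c ∈ Icc 0 (T i)) (h : ℝ) :
    ∫⁻ t in {t : E p | |t i - c| ≤ h}, ‖f.1 t - f.1 (faceProj i c t)‖ₑ ^ 2 ∂(boxMeasure T) ≤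
      ENNReal.ofReal h * ENNReal.ofReal (2 * h) *
        ∫⁻ t, ‖partialDeriv i f.1 t‖ₑ ^ 2 ∂(boxMeasure T) := by
  set A : Set ℝ := {r | |r - c| ≤ h} with hAdef
  have hA : MeasurableSet A := measurableSet_le (by fun_prop) measurable_const
  have hS : MeasurableSet {t : E p | t i ∈ A} :=
    hA.preimage ((measurable_pi_apply i).comp
      (MeasurableEquiv.toLp 2 (Fin p → ℝ)).symm.measurable)
  have hφ : Measurable fun t : E p => ‖partialDeriv i f.1 t‖ₑ ^ 2 :=
    (((isTest f).continuous_partialDeriv i).measurable.enorm).pow_const 2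
  have hvol : volume.restrict (Icc 0 (T i)) A ≤ ENNReal.ofReal (2 * h) := by
    refine (Measure.restrict_apply_le _ _).trans (le_of_eq ?_)
    have : A = Metric.closedBall c h := by
      ext r
      simp [hAdef, Real.dist_eq]
    rw [this, Real.volume_closedBall]
  calc ∫⁻ t in {t : E p | t i ∈ A}, ‖f.1 t - f.1 (faceProj i c t)‖ₑ ^ 2 ∂(boxMeasure T)
      ≤ ∫⁻ t in {t : E p | t i ∈ A}, (ENNReal.ofReal h *
          ∫⁻ r in Icc 0 (T i), ‖partialDeriv i f.1 (faceProj i r t)‖ₑ ^ 2) ∂(boxMeasure T) := by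
        refine lintegral_mono_ae ?_
        filter_upwards [ae_restrict_mem hS, ae_restrict_of_ae ae_mem_box] with t h1 h2
        refine (enorm_sub_faceProj_sq_le f i hc h2).trans ?_
        gcongr
        exact h1
    _ = ENNReal.ofReal h * (volume.restrict (Icc 0 (T i)) A *
          ∫⁻ t, ‖partialDeriv i f.1 t‖ₑ ^ 2 ∂(boxMeasure T)) := by
        rw [lintegral_const_mul' _ _ ENNReal.ofReal_ne_top, setLIntegral_slab i hA hφ]
    _ ≤ _ := by
        rw [mul_assoc]
        gcongr

theorem eLpNorm_two_sq {X G : Type*} [MeasurableSpace X] [NormedAddCommGroup G] (μ : Measure X)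
    (g : X → G) : eLpNorm g 2 μ ^ 2 = ∫⁻ x, ‖g x‖ₑ ^ 2 ∂μ := by
  have := eLpNorm_nnreal_pow_eq_lintegral (f := g) (μ := μ) (p := 2) (by norm_num)
  simpa using this

/-- The crude constant `2 h` in place of `√2 h` is harmless: only the order `h` matters, since its
square divided by `h` still tends to `0`. -/
theorem eLpNorm_layer_le (f : testFunctions T n) (i : Fin p) {c : ℝ}
    (hc : c ∈ Icc 0 (T i)) {h : ℝ} (hh : 0 ≤ h) :
    eLpNorm (fun t => f.1 t - f.1 (faceProj i c t)) 2
      ((boxMeasure T).restrict {t : E p | |t i - c| ≤ h}) ≤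
      ENNReal.ofReal (2 * h) * ‖testDeriv i f‖ₑ := by
  rw [← ENNReal.pow_le_pow_left_iff two_ne_zero, eLpNorm_two_sq, mul_pow]
  refine (setLIntegral_layer_le f i hc h).trans ?_
  rw [Lp.enorm_def, eLpNorm_congr_ae (coeFn_testDeriv i f), eLpNorm_two_sq, sq (ENNReal.ofReal _)]
  gcongr
  linarith

/-- The restriction of a test function to a face, extended constantly along the axis. -/
def testTrace (i : Fin p) : testFunctions T n →ₗ[ℝ] L2Box T n where
  toFun f := (memLp_of_continuous ((isTest f).smooth.continuous.comp
    (continuous_faceProj i 0))).toLp (f.1 ∘ faceProj i 0)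
  map_add' _ _ := rfl
  map_smul' _ _ := rfl

theorem coeFn_testTrace (i : Fin p) (f : testFunctions T n) :
    testTrace i f =ᵐ[boxMeasure T] f.1 ∘ faceProj i 0 :=
  MemLp.coeFn_toLp (memLp_of_continuous ((isTest f).smooth.continuous.comp
    (continuous_faceProj i 0)))

theorem test_faceProj_period (f : testFunctions T n) (i : Fin p) (t : E p) :
    f.1 (faceProj i (T i) t) = f.1 (faceProj i 0 t) := by
  rw [faceProj_eq, ← (isTest f).periodic i (faceProj i 0 t)]
  refine congrArg _ (congrArg _ ?_)
  ext j
  by_cases h : j = i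
  · subst h
    simp
  · simp [h]

/-- By periodicity the values on `t i = 0` are also those on `t i = T i`, so one function serves
both faces. -/
theorem eLpNorm_sub_testTrace_layer_le (f : testFunctions T n) (i : Fin p) (hT : 0 < T i) {c : ℝ}
    (hc : c = 0 ∨ c = T i) {h : ℝ} (hh : 0 ≤ h) :
    eLpNorm (testL2 f - testTrace i f : L2Box T n) 2
      ((boxMeasure T).restrict {t : E p | |t i - c| ≤ h}) ≤
      ENNReal.ofReal (2 * h) * ‖testDeriv i f‖ₑ := by
  have hc' : c ∈ Icc 0 (T i) := by
    rcases hc with rfl | rfl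
    · exact ⟨le_rfl, hT.le⟩
    · exact ⟨hT.le, le_rfl⟩
  refine (le_of_eq ?_).trans (eLpNorm_layer_le f i hc' hh)
  refine eLpNorm_congr_ae (ae_restrict_of_ae ?_)
  filter_upwards [Lp.coeFn_sub (testL2 f) (testTrace i f), coeFn_testL2 f, coeFn_testTrace i f]
    with t h1 h2 h3
  rw [h1, Pi.sub_apply, h2, h3]
  rcases hc with rfl | rfl
  · rfl
  · rw [test_faceProj_period]
    rfl

/-- The layer of thickness `T i` at `t i = 0` is the whole box, so the layer estimate gives
continuity of the trace in the `H¹` norm. -/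
theorem norm_testTrace_le (hT : ∀ α, 0 < T α) (i : Fin p) (f : testFunctions T n) :
    ‖testTrace i f‖ ≤ (1 + 2 * T i) * ‖testH1 hT f‖ := by
  have h1 : ‖testL2 f - testTrace i f‖ ≤ 2 * T i * ‖testDeriv i f‖ := by
    have h := eLpNorm_sub_testTrace_layer_le f i (hT i) (Or.inl rfl) (hT i).le
    have e : (boxMeasure T).restrict {t : E p | |t i - 0| ≤ T i} = boxMeasure T := by
      refine Measure.restrict_eq_self_of_ae_mem ?_
      filter_upwards [ae_mem_box] with t ht
      have := ht i
      simp only [sub_zero]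
      rw [abs_of_nonneg this.1]
      exact this.2
    rw [e, ← Lp.enorm_def, ← ofReal_norm, ← ofReal_norm (testDeriv i f),
      ← ENNReal.ofReal_mul (by linarith [hT i])] at h
    exact (ENNReal.ofReal_le_ofReal_iff (by have := (hT i).le; positivity)).1 h
  have hsq := H1T_norm_sq (testH1 hT f)
  simp only [toL2_testH1, wderiv_testH1] at hsq
  have h2 : ‖testL2 f‖ ≤ ‖testH1 hT f‖ := by
    refine le_of_sq_le_sq ?_ (norm_nonneg _)
    rw [hsq]
    exact le_add_of_nonneg_right (Finset.sum_nonneg fun _ _ => sq_nonneg _)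
  have h3 : ‖testDeriv i f‖ ≤ ‖testH1 hT f‖ := by
    refine le_of_sq_le_sq ?_ (norm_nonneg _)
    rw [hsq]
    exact (Finset.single_le_sum (f := fun α => ‖testDeriv α f‖ ^ 2) (fun _ _ => sq_nonneg _)
      (Finset.mem_univ i)).trans (le_add_of_nonneg_left (sq_nonneg _))
  have h4 : ‖testTrace i f‖ ≤ ‖testL2 f‖ + ‖testL2 f - testTrace i f‖ := by
    have := norm_sub_le (testL2 f) (testL2 f - testTrace i f)
    rwa [sub_sub_cancel] at this
  have h5 := mul_le_mul_of_nonneg_left h3 (by linarith [hT i] : 0 ≤ 2 * T i)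
  linarith

/-- Elements of `H¹_T` have equal traces on opposite faces of the box. -/
theorem equalTraces_toL2 (hT : ∀ α, 0 < T α) (u : H1T T n) (i : Fin p) :
    EqualTraces T (toL2 u) i := by
  set C := 1 + 2 * T i with hC
  have hC0 : 0 ≤ C := by linarith [hT i]
  have hhalf : ∀ m : ℕ, (0 : ℝ) < (1 / 2) ^ m := fun m => by positivity
  choose f hf using fun m : ℕ => exists_norm_sub_testH1_lt hT u (hhalf m)
  have hcau : CauchySeq fun m => testTrace i (f m) := by
    -- The factor `2` absorbs the two consecutive errors `(1 / 2) ^ m` and `(1 / 2) ^ (m + 1)`.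
    refine cauchySeq_of_le_geometric (1 / 2) (C * 2) (by norm_num) fun m => ?_
    rw [dist_eq_norm, ← map_sub]
    refine (norm_testTrace_le hT i _).trans ?_
    rw [map_sub, mul_assoc]
    refine mul_le_mul_of_nonneg_left ?_ hC0
    have h1 : testH1 hT (f m) - testH1 hT (f (m + 1)) =
        (u - testH1 hT (f (m + 1))) - (u - testH1 hT (f m)) := by abel
    rw [h1]
    refine (norm_sub_le _ _).trans ?_
    have h2 := hf m
    have h3 := hf (m + 1)
    rw [pow_succ] at h3
    linarith [hhalf m]
  obtain ⟨G, hG⟩ := cauchySeq_tendsto_of_complete hcau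
  have hu : Tendsto (fun m => ‖u - testH1 hT (f m)‖) atTop (𝓝 0) :=
    squeeze_zero (fun m => norm_nonneg _) (fun m => (hf m).le)
      (tendsto_pow_atTop_nhds_zero_of_lt_one (by norm_num) (by norm_num))
  have huf : Tendsto (fun m => testL2 (f m)) atTop (𝓝 (toL2 u)) := by
    rw [tendsto_iff_norm_sub_tendsto_zero]
    refine squeeze_zero (fun m => norm_nonneg _) (fun m => ?_) hu
    rw [norm_sub_rev]
    refine le_of_sq_le_sq ?_ (norm_nonneg _)
    rw [H1T_norm_sq]
    exact le_add_of_nonneg_right (Finset.sum_nonneg fun _ _ => sq_nonneg _)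
  have hdf : Tendsto (fun m => testDeriv i (f m)) atTop (𝓝 (wderiv u i)) := by
    rw [tendsto_iff_norm_sub_tendsto_zero]
    refine squeeze_zero (fun m => norm_nonneg _) (fun m => ?_) hu
    rw [norm_sub_rev]
    refine le_of_sq_le_sq ?_ (norm_nonneg _)
    rw [H1T_norm_sq]
    exact (Finset.single_le_sum (f := fun α => ‖wderiv (u - testH1 hT (f m)) α‖ ^ 2)
      (fun _ _ => sq_nonneg _) (Finset.mem_univ i)).trans (le_add_of_nonneg_left (sq_nonneg _))
  -- The layer estimate of the approximants passes to the limit, because every term in it converges.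
  have hlayer : ∀ c, (c = 0 ∨ c = T i) → ∀ h, 0 ≤ h → eLpNorm (toL2 u - G : L2Box T n) 2
      ((boxMeasure T).restrict {t : E p | |t i - c| ≤ h}) ≤
      ENNReal.ofReal (2 * h) * ‖wderiv u i‖ₑ := by
    intro c hc h hh
    set S := {t : E p | |t i - c| ≤ h} with hS
    have hb : ∀ v : L2Box T n, eLpNorm v 2 ((boxMeasure T).restrict S) ≤ ‖v‖ₑ := fun v => by
      rw [Lp.enorm_def]
      exact eLpNorm_mono_measure _ Measure.restrict_le_self
    have hm : ∀ v : L2Box T n, AEStronglyMeasurable v ((boxMeasure T).restrict S) := fun v =>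
      (Lp.aestronglyMeasurable v).restrict
    have hadd : ∀ v w : L2Box T n, eLpNorm (v + w : L2Box T n) 2 ((boxMeasure T).restrict S) ≤
        eLpNorm v 2 ((boxMeasure T).restrict S) + eLpNorm w 2 ((boxMeasure T).restrict S) :=
      fun v w => by
        rw [eLpNorm_congr_ae (ae_restrict_of_ae (Lp.coeFn_add v w))]
        exact eLpNorm_add_le (hm v) (hm w) (by norm_num)
    have hle : ∀ m, eLpNorm (toL2 u - G : L2Box T n) 2 ((boxMeasure T).restrict S) ≤
        ‖toL2 u - testL2 (f m)‖ₑ + ENNReal.ofReal (2 * h) * ‖testDeriv i (f m)‖ₑ +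
          ‖testTrace i (f m) - G‖ₑ := fun m => by
      have e : toL2 u - G = (toL2 u - testL2 (f m)) + (testL2 (f m) - testTrace i (f m)) +
        (testTrace i (f m) - G) := by abel
      rw [e]
      refine (hadd _ _).trans (add_le_add ((hadd _ _).trans (add_le_add (hb _) ?_)) (hb _))
      exact eLpNorm_sub_testTrace_layer_le (f m) i (hT i) hc hh
    have lim : Tendsto (fun m => ‖toL2 u - testL2 (f m)‖ₑ +
        ENNReal.ofReal (2 * h) * ‖testDeriv i (f m)‖ₑ + ‖testTrace i (f m) - G‖ₑ) atTop
        (𝓝 (‖toL2 u - toL2 u‖ₑ + ENNReal.ofReal (2 * h) * ‖wderiv u i‖ₑ + ‖G - G‖ₑ)) :=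
      ((tendsto_const_nhds.sub huf).enorm.add
        (ENNReal.Tendsto.const_mul hdf.enorm (Or.inr ENNReal.ofReal_ne_top))).add
          (hG.sub tendsto_const_nhds).enorm
    simpa using ge_of_tendsto' lim hle
  -- `G` is a class on the box, whereas a trace is a function on the face. Along a subsequence the
  -- restrictions converge almost everywhere, and `g` is their pointwise limit; the default value of
  -- `limUnder` enters only on a null set of projections.
  obtain ⟨ns, -, hns⟩ := (tendstoInMeasure_of_tendsto_Lp hG).exists_seq_tendsto_ae
  set g : E p → E n := fun t => limUnder atTop fun j => (f (ns j)).1 t with hg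
  have hgG : (fun t => g (faceProj i 0 t)) =ᵐ[boxMeasure T] G := by
    have hall : ∀ᵐ t ∂(boxMeasure T), ∀ j,
        testTrace i (f (ns j)) t = (f (ns j)).1 (faceProj i 0 t) :=
      ae_all_iff.2 fun j => coeFn_testTrace i _
    filter_upwards [hall, hns] with t h1 h2
    simp only [h1] at h2
    exact h2.limUnder_eq
  have htrace : ∀ c, (c = 0 ∨ c = T i) → ∀ k : E p → E n,
      (∀ t, k (faceProj i c t) = g (faceProj i 0 t)) → IsTrace T (toL2 u) i c k := by
    intro c hc k hk
    refine ⟨?_, ?_⟩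
    · simp only [hk]
      exact (memLp_congr_ae hgG).2 (Lp.memLp G)
    · have e : ∀ h : ℝ, ∫⁻ t in {t : E p | |t i - c| ≤ h},
          ‖toL2 u t - k (faceProj i c t)‖ₑ ^ 2 ∂(boxMeasure T) =
          eLpNorm (toL2 u - G : L2Box T n) 2
            ((boxMeasure T).restrict {t : E p | |t i - c| ≤ h}) ^ 2 := fun h => by
        rw [eLpNorm_two_sq]
        refine lintegral_congr_ae (ae_restrict_of_ae ?_)
        filter_upwards [hgG, Lp.coeFn_sub (toL2 u) G] with t h1 h2
        rw [hk, h1, h2, Pi.sub_apply]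
      simp only [e]
      have hlim : Tendsto (fun h : ℝ => ENNReal.ofReal (4 * h) * ‖wderiv u i‖ₑ ^ 2) (𝓝[>] 0)
          (𝓝 0) := by
        have h1 : Tendsto (fun h : ℝ => ENNReal.ofReal (4 * h)) (𝓝[>] 0) (𝓝 0) := by
          have : Continuous fun h : ℝ => ENNReal.ofReal (4 * h) :=
            ENNReal.continuous_ofReal.comp (continuous_const.mul continuous_id)
          simpa using (this.tendsto 0).mono_left nhdsWithin_le_nhds
        simpa using ENNReal.Tendsto.mul_const h1 (b := ‖wderiv u i‖ₑ ^ 2)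
          (Or.inr (ENNReal.pow_ne_top enorm_ne_top))
      refine tendsto_of_tendsto_of_tendsto_of_le_of_le' tendsto_const_nhds hlim
        (Eventually.of_forall fun _ => zero_le) ?_
      filter_upwards [self_mem_nhdsWithin] with h hh
      have hh0 : (0 : ℝ) < h := hh
      calc (ENNReal.ofReal h)⁻¹ * eLpNorm (toL2 u - G : L2Box T n) 2
            ((boxMeasure T).restrict {t : E p | |t i - c| ≤ h}) ^ 2
          ≤ (ENNReal.ofReal h)⁻¹ * (ENNReal.ofReal (2 * h) * ‖wderiv u i‖ₑ) ^ 2 := by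
            gcongr
            exact hlayer c hc h hh0.le
        _ = ENNReal.ofReal (4 * h) * ‖wderiv u i‖ₑ ^ 2 := by
            rw [mul_pow, ← mul_assoc, ← ENNReal.ofReal_inv_of_pos hh0,
              ← ENNReal.ofReal_pow (by positivity), ← ENNReal.ofReal_mul (by positivity)]
            congr 2
            field_simp
            norm_num
  refine ⟨g, fun t => g (faceProj i 0 t), htrace 0 (Or.inl rfl) g fun _ => rfl,
    htrace (T i) (Or.inr rfl) _ fun t => ?_, Eventually.of_forall fun t => ?_⟩
  · simp only [faceProj_faceProj]
  · simp only [faceProj_faceProj]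

/-! ### The lattice of periods and uniform bounds. -/

/-- A vector of the lattice generated by the multiples `P i` of the canonical basis. -/
def latticeVec (P : Fin n → ℝ) (m : Fin n → ℤ) : E n :=
  ∑ i, m i • (P i • EuclideanSpace.single i (1 : ℝ))

theorem latticeVec_apply (P : Fin n → ℝ) (m : Fin n → ℤ) (j : Fin n) :
    latticeVec P m j = m j * P j := by
  simp only [latticeVec, WithLp.ofLp_sum, Finset.sum_apply]
  rw [Finset.sum_eq_single j]
  · simp
  · intro i _ hi
    simp [hi.symm]
  · simp

theorem periodic_latticeVec {X : Type*} {h : E n → X} {P : Fin n → ℝ}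
    (hh : ∀ i x, h (x + P i • EuclideanSpace.single i (1 : ℝ)) = h x) (m : Fin n → ℤ) :
    Function.Periodic h (latticeVec P m) :=
  Finset.sum_induction _ (Function.Periodic h) (fun _ _ ha hb => ha.add_period hb)
    (fun x => by rw [add_zero]) fun i _ => Function.Periodic.zsmul (fun x => hh i x) (m i)

theorem exists_int_abs_add_mul_le {P : ℝ} (hP : P ≠ 0) (x : ℝ) : ∃ m : ℤ, |x + m * P| ≤ |P| := by
  refine ⟨-round (x / P), ?_⟩
  have h := abs_sub_round (x / P)
  have e : x + ((-round (x / P) : ℤ) : ℝ) * P = (x / P - round (x / P)) * P := by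
    push_cast
    field_simp
    ring
  rw [e, abs_mul]
  nlinarith [abs_nonneg P]

/-- A function on the box times `ℝⁿ` that is periodic in the second variable and satisfies a growth
condition is bounded. -/
theorem exists_bound_of_periodic {X : Type*} [NormedAddCommGroup X] {G : E p → E n → X}
    {P : Fin n → ℝ} (hP : ∀ i, P i ≠ 0)
    (hper : ∀ i, ∀ t ∈ box T, ∀ x, G t (x + P i • EuclideanSpace.single i (1 : ℝ)) = G t x)
    {a : ℝ → ℝ} (ha : ContinuousOn a (Ici 0)) {b : E p → ℝ} (hb : ContinuousOn b (box T))
    (hG : ∀ t ∈ box T, ∀ x, ‖G t x‖ ≤ a ‖x‖ * b t) :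
    ∃ C, ∀ t ∈ box T, ∀ x, ‖G t x‖ ≤ C := by
  -- Every point is congruent to one with coordinates `|x i| ≤ |P i|`, hence of norm at most `R`.
  set R := Real.sqrt (∑ i, P i ^ 2) with hR
  obtain ⟨A, hA⟩ := (isCompact_Icc (a := 0) (b := R)).exists_bound_of_continuousOn
    (ha.mono Icc_subset_Ici_self)
  obtain ⟨B, hB⟩ := (isCompact_box T).exists_bound_of_continuousOn hb
  refine ⟨A * B, fun t ht x => ?_⟩
  choose m hm using fun i => exists_int_abs_add_mul_le (hP i) (x i)
  have hx : ‖x + latticeVec P m‖ ≤ R := by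
    rw [EuclideanSpace.norm_eq, hR]
    refine Real.sqrt_le_sqrt (Finset.sum_le_sum fun i _ => ?_)
    rw [PiLp.add_apply, latticeVec_apply, Real.norm_eq_abs, sq_le_sq, abs_abs]
    exact hm i
  rw [← periodic_latticeVec (fun i y => hper i t ht y) m x]
  refine (hG t ht _).trans ((le_abs_self _).trans ?_)
  rw [abs_mul]
  have h1 := hA ‖x + latticeVec P m‖ ⟨norm_nonneg _, hx⟩
  have h2 := hB t ht
  exact mul_le_mul h1 h2 (abs_nonneg _) ((norm_nonneg _).trans h1)

theorem gradient_periodic {h : E n → ℝ} {c : E n} (hh : ∀ x, h (x + c) = h x) (x : E n) :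
    gradient h (x + c) = gradient h x := by
  have : fderiv ℝ h (x + c) = fderiv ℝ h x := by
    rw [← fderiv_comp_add_right c]
    congr 1
    exact funext hh
  rw [gradient, gradient, this]

theorem inner_gradient {h : E n → ℝ} (x y : E n) : inner ℝ (gradient h x) y = fderiv ℝ h x y := by
  rw [gradient, InnerProductSpace.toDual_symm_apply]

/-! ### Measurability, differentiability of the action, Euler–Lagrange equation. -/

/-- Composition of a Carathéodory function with a measurable function. -/
theorem aemeasurable_caratheodory {F : E p → E n → ℝ}
    (hF : ∀ x, AEMeasurable (fun t => F t x) (boxMeasure T))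
    (hc : ∀ t ∈ box T, Continuous (F t)) {u : E p → E n}
    (hu : AEStronglyMeasurable u (boxMeasure T)) :
    AEMeasurable (fun t => F t (u t)) (boxMeasure T) := by
  -- On each of the finitely many level sets of a simple function the second argument is frozen;
  -- continuity in it then covers limits of simple functions.
  have hsimple : ∀ s : SimpleFunc (E p) (E n),
      AEMeasurable (fun t => F t (s t)) (boxMeasure T) := by
    intro s
    have e : (fun t => F t (s t)) =
        fun t => ∑ x ∈ s.range, (s ⁻¹' {x}).indicator (fun t => F t x) t := by
      funext t
      rw [Finset.sum_eq_single (s t)]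
      · simp
      · intro x _ hx
        exact indicator_of_notMem (fun h => hx h.symm) _
      · exact fun h => absurd (s.mem_range_self t) h
    rw [e]
    exact Finset.aemeasurable_fun_sum _ fun x _ => (hF x).indicator (s.measurableSet_fiber x)
  have hlim : AEMeasurable (fun t => F t (hu.mk u t)) (boxMeasure T) := by
    refine aemeasurable_of_tendsto_metrizable_ae atTop
      (fun m => hsimple (hu.stronglyMeasurable_mk.approx m)) ?_
    filter_upwards [ae_mem_box] with t ht
    exact ((hc t ht).tendsto _).comp (hu.stronglyMeasurable_mk.tendsto_approx t)
  refine hlim.congr ?_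
  filter_upwards [hu.ae_eq_mk] with t ht
  rw [ht]

/-- Each coordinate is the limit of difference quotients with step `1 / (m + 1)`, which are
compositions of Carathéodory type. -/
theorem aestronglyMeasurable_gradient {F : E p → E n → ℝ}
    (hF : ∀ x, AEMeasurable (fun t => F t x) (boxMeasure T))
    (hc : ∀ t ∈ box T, ContDiff ℝ 1 (F t)) {u : E p → E n}
    (hu : AEStronglyMeasurable u (boxMeasure T)) :
    AEStronglyMeasurable (fun t => gradient (F t) (u t)) (boxMeasure T) := by
  have hcoord : ∀ j, AEMeasurable (fun t => gradient (F t) (u t) j) (boxMeasure T) := by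
    intro j
    have hm : ∀ m : ℕ, AEMeasurable (fun t => ((1 : ℝ) / (m + 1))⁻¹ •
        (F t (u t + ((1 : ℝ) / (m + 1)) • EuclideanSpace.single j (1 : ℝ)) - F t (u t)))
        (boxMeasure T) := fun m => by
      have h1 : AEMeasurable (fun t => F t (u t + ((1 : ℝ) / (m + 1)) •
          EuclideanSpace.single j (1 : ℝ))) (boxMeasure T) :=
        aemeasurable_caratheodory hF (fun t ht => (hc t ht).continuous)
          (hu.add aestronglyMeasurable_const)
      exact (h1.sub (aemeasurable_caratheodory hF
        (fun t ht => (hc t ht).continuous) hu)).const_smul ((1 : ℝ) / (m + 1))⁻¹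
    refine aemeasurable_of_tendsto_metrizable_ae atTop hm ?_
    filter_upwards [ae_mem_box] with t ht
    have hd := ((hc t ht).differentiable (by simp) (u t)).hasFDerivAt.hasLineDerivAt
      (EuclideanSpace.single j (1 : ℝ))
    have hd' := (hasDerivAt_iff_tendsto_slope_zero.1 hd).comp
      (tendsto_nhdsWithin_iff.2 ⟨tendsto_one_div_add_atTop_nhds_zero_nat (𝕜 := ℝ),
        Eventually.of_forall fun m => by
          have : (0 : ℝ) < 1 / ((m : ℝ) + 1) := by positivity
          exact this.ne'⟩)
    rw [← inner_gradient, EuclideanSpace.inner_single_right] at hd'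
    simpa [Function.comp_def] using hd'
  have := (MeasurableEquiv.toLp 2 (Fin n → ℝ)).measurable.comp_aemeasurable
    (aemeasurable_pi_lambda _ hcoord)
  exact this.aestronglyMeasurable

theorem integrable_of_bound {F : E p → E n → ℝ}
    (hF : ∀ x, AEMeasurable (fun t => F t x) (boxMeasure T))
    (hc : ∀ t ∈ box T, Continuous (F t)) {C : ℝ} (hC : ∀ t ∈ box T, ∀ x, ‖F t x‖ ≤ C)
    {u : E p → E n} (hu : AEStronglyMeasurable u (boxMeasure T)) :
    Integrable (fun t => F t (u t)) (boxMeasure T) := by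
  refine Integrable.of_bound (aemeasurable_caratheodory hF hc hu).aestronglyMeasurable C ?_
  filter_upwards [ae_mem_box] with t ht
  exact hC t ht _

theorem L2_norm_sq (u : L2Box T n) : ‖u‖ ^ 2 = ∫ t, ‖u t‖ ^ 2 ∂(boxMeasure T) := by
  rw [← real_inner_self_eq_norm_sq, L2.inner_def]
  simp only [real_inner_self_eq_norm_sq]

theorem integrable_norm_sq (u : L2Box T n) :
    Integrable (fun t => ‖u t‖ ^ 2) (boxMeasure T) :=
  (Lp.memLp u).integrable_norm_pow two_ne_zero

theorem action_eq {F : E p → E n → ℝ}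
    (hF : ∀ x, AEMeasurable (fun t => F t x) (boxMeasure T))
    (hc : ∀ t ∈ box T, Continuous (F t)) {C : ℝ} (hC : ∀ t ∈ box T, ∀ x, ‖F t x‖ ≤ C)
    (u : H1T T n) :
    action T F u = (1 / 2) * (∑ α, ‖wderiv u α‖ ^ 2) + potentialAction T F u := by
  rw [action, potentialAction, integral_add, integral_const_mul, integral_finsetSum]
  · simp only [L2_norm_sq]
  · exact fun α _ => integrable_norm_sq _
  · exact (integrable_finsetSum _ fun α _ => integrable_norm_sq _).const_mul _
  · exact integrable_of_bound hF hc hC (Lp.aestronglyMeasurable _)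

/-- Differentiation under the integral sign: the global bound on the gradient gives the dominating
function `C' * ‖f‖`, valid for all `s`. -/
theorem hasDerivAt_potentialAction (hT : ∀ α, 0 < T α) {F : E p → E n → ℝ}
    (hF : ∀ x, AEMeasurable (fun t => F t x) (boxMeasure T))
    (hc : ∀ t ∈ box T, ContDiff ℝ 1 (F t)) {C : ℝ} (hC : ∀ t ∈ box T, ∀ x, ‖F t x‖ ≤ C)
    {C' : ℝ} (hC' : ∀ t ∈ box T, ∀ x, ‖gradient (F t) x‖ ≤ C') (u : H1T T n)
    (f : testFunctions T n) :
    HasDerivAt (fun s : ℝ => potentialAction T F (u + s • testH1 hT f))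
      (∫ t, inner ℝ (gradient (F t) (toL2 u t)) (f.1 t) ∂(boxMeasure T)) 0 := by
  have hcont : ∀ t ∈ box T, Continuous (F t) := fun t ht => (hc t ht).continuous
  have hfm : AEStronglyMeasurable f.1 (boxMeasure T) :=
    (isTest f).smooth.continuous.aestronglyMeasurable
  have hum : AEStronglyMeasurable (toL2 u) (boxMeasure T) := Lp.aestronglyMeasurable _
  have e : ∀ s : ℝ, potentialAction T F (u + s • testH1 hT f) =
      ∫ t, F t (toL2 u t + s • f.1 t) ∂(boxMeasure T) := fun s => by
    refine integral_congr_ae ?_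
    filter_upwards [Lp.coeFn_add (toL2 u) (s • testL2 f), Lp.coeFn_smul s (testL2 f),
      coeFn_testL2 f] with t h1 h2 h3
    change F t ((toL2 u + s • testL2 f : L2Box T n) t) = _
    rw [h1, Pi.add_apply, h2, Pi.smul_apply, h3]
  simp only [e]
  have hfint : Integrable f.1 (boxMeasure T) :=
    (memLp_of_continuous (isTest f).smooth.continuous).integrable (by norm_num)
  have key := hasDerivAt_integral_of_dominated_loc_of_deriv_le (μ := boxMeasure T) (x₀ := (0 : ℝ))
    (F := fun s t => F t (toL2 u t + s • f.1 t))
    (F' := fun s t => inner ℝ (gradient (F t) (toL2 u t + s • f.1 t)) (f.1 t))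
    (bound := fun t => C' * ‖f.1 t‖) (s := univ) univ_mem
    (Eventually.of_forall fun s =>
      (aemeasurable_caratheodory hF hcont (hum.add (hfm.const_smul s))).aestronglyMeasurable)
    (integrable_of_bound hF hcont hC (hum.add (hfm.const_smul (0 : ℝ))))
    ((aestronglyMeasurable_gradient hF hc (hum.add (hfm.const_smul (0 : ℝ)))).inner hfm)
    (by
      filter_upwards [ae_mem_box] with t ht s _
      refine (norm_inner_le_norm _ _).trans ?_
      gcongr
      exact hC' t ht _)
    (hfint.norm.const_mul C')
    (by
      filter_upwards [ae_mem_box] with t ht s _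
      have h1 : HasDerivAt (fun s : ℝ => toL2 u t + s • f.1 t) (f.1 t) s := by
        simpa using ((hasDerivAt_id s).smul_const (f.1 t)).const_add (toL2 u t)
      have h2 := ((hc t ht).differentiable (by simp)
        (toL2 u t + s • f.1 t)).hasFDerivAt.comp_hasDerivAt s h1
      rw [inner_gradient]
      exact h2)
  simpa using key.2

/-- The Euler–Lagrange equation: a minimizer of the action has the gradient of the potential as
weak Laplacian. -/
theorem exists_isWeakLaplacian_of_minimizer (hT : ∀ α, 0 < T α) {F : E p → E n → ℝ}
    (hF : ∀ x, AEMeasurable (fun t => F t x) (boxMeasure T))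
    (hc : ∀ t ∈ box T, ContDiff ℝ 1 (F t)) {C : ℝ} (hC : ∀ t ∈ box T, ∀ x, ‖F t x‖ ≤ C)
    {C' : ℝ} (hC' : ∀ t ∈ box T, ∀ x, ‖gradient (F t) x‖ ≤ C') {u : H1T T n}
    (hu : ∀ v, action T F u ≤ action T F v) :
    ∃ w : L2Box T n, IsWeakLaplacian T u w ∧
      ∀ᵐ t ∂(boxMeasure T), w t = gradient (F t) (toL2 u t) := by
  have hcont : ∀ t ∈ box T, Continuous (F t) := fun t ht => (hc t ht).continuous
  have hmem : MemLp (fun t => gradient (F t) (toL2 u t)) 2 (boxMeasure T) := by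
    refine MemLp.of_bound (aestronglyMeasurable_gradient hF hc (Lp.aestronglyMeasurable _)) C' ?_
    filter_upwards [ae_mem_box] with t ht
    exact hC' t ht _
  refine ⟨hmem.toLp _, isWeakLaplacian_iff.2 fun f => ?_, hmem.coeFn_toLp⟩
  have h1 := hasDerivAt_potentialAction hT hF hc hC hC' u f
  have h2 : ∀ α, HasDerivAt (fun s : ℝ => ‖wderiv (u + s • testH1 hT f) α‖ ^ 2)
      (2 * inner ℝ (wderiv u α) (testDeriv α f)) 0 := fun α => by
    have h3 : HasDerivAt (fun s : ℝ => wderiv u α + s • testDeriv α f) (testDeriv α f) 0 := by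
      simpa using ((hasDerivAt_id (0 : ℝ)).smul_const (testDeriv α f)).const_add (wderiv u α)
    simpa using h3.norm_sq
  have h3 := ((HasDerivAt.fun_sum fun α (_ : α ∈ Finset.univ) => h2 α).const_mul (1 / 2)).add h1
  have hmin : IsLocalMin (fun s : ℝ => action T F (u + s • testH1 hT f)) 0 :=
    Eventually.of_forall fun s => by simpa using hu (u + s • testH1 hT f)
  have h4 := hmin.hasDerivAt_eq_zero (h3.congr_of_eventuallyEq
    (Eventually.of_forall fun s => action_eq hF hcont hC _))
  rw [← Finset.mul_sum] at h4
  have h5 : inner ℝ (hmem.toLp _) (testL2 f) =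
      ∫ t, inner ℝ (gradient (F t) (toL2 u t)) (f.1 t) ∂(boxMeasure T) := by
    rw [inner_testL2]
    refine integral_congr_ae ?_
    filter_upwards [hmem.coeFn_toLp] with t ht
    rw [ht]
  rw [h5]
  linarith

/-! ### The direct method. -/

/-- Bounded sequences in a Hilbert space have weakly convergent subsequences. -/
theorem exists_weakly_convergent_subseq {H : Type*} [NormedAddCommGroup H] [InnerProductSpace ℝ H]
    [CompleteSpace H] {x : ℕ → H} {R : ℝ} (hx : ∀ k, ‖x k‖ ≤ R) :
    ∃ (v : H) (ns : ℕ → ℕ), StrictMono ns ∧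
      ∀ l : H →L[ℝ] ℝ, Tendsto (fun k => l (x (ns k))) atTop (𝓝 (l v)) := by
  -- Sequential Banach–Alaoglu needs separability, which the closed span of the sequence has.
  set K : Submodule ℝ H := (Submodule.span ℝ (range x)).topologicalClosure with hK
  have hsep : TopologicalSpace.SeparableSpace K := by
    refine TopologicalSpace.IsSeparable.separableSpace ?_
    rw [hK, Submodule.topologicalClosure_coe]
    exact ((countable_range x).isSeparable.span (R := ℝ)).closure
  have hcomp : CompleteSpace K := (Submodule.isClosed_topologicalClosure _).completeSpace_coe
  have hxK : ∀ k, x k ∈ K := fun k =>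
    Submodule.le_topologicalClosure _ (Submodule.subset_span ⟨k, rfl⟩)
  obtain ⟨ψ, -, ns, hns, hψ⟩ := WeakDual.isSeqCompact_closedBall ℝ K 0 R
    (x := fun k => StrongDual.toWeakDual (InnerProductSpace.toDual ℝ K ⟨x k, hxK k⟩)) fun k => by
      simpa [mem_closedBall_zero_iff] using hx k
  refine ⟨((InnerProductSpace.toDual ℝ K).symm (WeakDual.toStrongDual ψ) : K), ns, hns,
    fun l => ?_⟩
  set z : K := (InnerProductSpace.toDual ℝ K).symm (l.comp K.subtypeL) with hz
  have hl : ∀ y : K, l y = inner ℝ z y := fun y => by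
    rw [hz, InnerProductSpace.toDual_symm_apply]
    rfl
  have h1 := ((WeakBilin.eval_continuous (topDualPairing ℝ K) z).tendsto ψ).comp hψ
  have h2 : l ((InnerProductSpace.toDual ℝ K).symm (WeakDual.toStrongDual ψ) : K) = ψ z := by
    rw [hl, real_inner_comm, InnerProductSpace.toDual_symm_apply]
    rfl
  rw [h2]
  refine h1.congr fun k => ?_
  rw [hl ⟨x (ns k), hxK (ns k)⟩, real_inner_comm]
  rfl

theorem boxMeasure_real_univ_pos (hT : ∀ α, 0 < T α) : 0 < (boxMeasure T).real univ := by
  have h : boxMeasure T univ = ∏ α, ENNReal.ofReal (T α) := by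
    rw [← measurePreserving_toLp_boxMeasure.measure_preimage MeasurableSet.univ.nullMeasurableSet,
      preimage_univ, Measure.pi_univ]
    simp
  rw [Measure.real, h, ENNReal.toReal_prod]
  refine Finset.prod_pos fun α _ => ?_
  rw [ENNReal.toReal_ofReal (hT α).le]
  exact hT α

/-- Constant functions as test functions. -/
def constTest (T : Fin p → ℝ) (z : E n) : testFunctions T n :=
  ⟨fun _ => z, contDiff_const, fun _ _ => rfl⟩

theorem testDeriv_constTest (α : Fin p) (z : E n) : testDeriv α (constTest T z) = 0 := by
  rw [testDeriv_eq_testL2 (g := 0), map_zero]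
  intro t
  simp [partialDeriv, constTest]

theorem inner_constTest_cosMode (z : E n) (j : Fin n) :
    inner ℝ (testL2 (constTest T z)) (testL2 (cosMode T 0 j)) =
      (boxMeasure T).real univ * z j := by
  rw [inner_testL2]
  have : ∀ᵐ t ∂(boxMeasure T), inner ℝ (testL2 (constTest T z) t) ((cosMode T 0 j).1 t) = z j := by
    filter_upwards [coeFn_testL2 (constTest T z)] with t ht
    rw [ht, cosMode_zero, EuclideanSpace.inner_single_right]
    simp [constTest]
  rw [integral_congr_ae this, integral_const, smul_eq_mul]

/-- Translating by a vector of the lattice of periods bounds the mean of a function. -/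
theorem exists_translate (hT : ∀ α, 0 < T α) {F : E p → E n → ℝ} {P : Fin n → ℝ}
    (hP : ∀ i, P i ≠ 0)
    (hper : ∀ i, ∀ t ∈ box T, ∀ x, F t (x + P i • EuclideanSpace.single i (1 : ℝ)) = F t x)
    (u : H1T T n) : ∃ v : H1T T n, (∀ α, wderiv v α = wderiv u α) ∧
      potentialAction T F v = potentialAction T F u ∧
      ∀ j, |inner ℝ (toL2 v) (testL2 (cosMode T 0 j))| ≤ |(boxMeasure T).real univ * P j| := by
  have hV := boxMeasure_real_univ_pos hT
  -- Pairing with the zero mode integrates the `j`-th component. A lattice constant shifts this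
  -- integral by a multiple of the volume times `P j`, so the rounding is done modulo that product.
  choose m hm using fun j => exists_int_abs_add_mul_le (mul_ne_zero hV.ne' (hP j))
    (inner ℝ (toL2 u) (testL2 (cosMode T 0 j)))
  refine ⟨u + testH1 hT (constTest T (latticeVec P m)), fun α => ?_, ?_, fun j => ?_⟩
  · rw [wderiv_add, wderiv_testH1, testDeriv_constTest, add_zero]
  · refine integral_congr_ae ?_
    filter_upwards [ae_mem_box, coeFn_testL2 (constTest T (latticeVec P m)),
      Lp.coeFn_add (toL2 u) (testL2 (constTest T (latticeVec P m)))] with t ht h1 h2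
    change F t ((toL2 u + testL2 (constTest T (latticeVec P m)) : L2Box T n) t) = _
    rw [h2, Pi.add_apply, h1]
    exact periodic_latticeVec (fun i x => hper i t ht x) m _
  · rw [toL2_add, toL2_testH1, inner_add_left, inner_constTest_cosMode, latticeVec_apply]
    refine le_of_eq_of_le (congrArg _ ?_) (hm j)
    ring

theorem norm_wderiv_le (u : H1T T n) (α : Fin p) : ‖wderiv u α‖ ≤ ‖u‖ := by
  refine le_of_sq_le_sq ?_ (norm_nonneg _)
  rw [H1T_norm_sq]
  exact (Finset.single_le_sum (f := fun α => ‖wderiv u α‖ ^ 2) (fun _ _ => sq_nonneg _)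
    (Finset.mem_univ α)).trans (le_add_of_nonneg_left (sq_nonneg _))

/-- The linear functional pairing the weak derivatives with those of a fixed element. -/
def derivPairing (v : H1T T n) : H1T T n →L[ℝ] ℝ :=
  LinearMap.mkContinuous
    { toFun := fun z => ∑ α, inner ℝ (wderiv v α) (wderiv z α)
      map_add' := fun y z => by simp [inner_add_right, Finset.sum_add_distrib]
      map_smul' := fun c z => by simp [real_inner_smul_right, Finset.mul_sum] }
    (∑ α, ‖wderiv v α‖) fun z => by
      change ‖∑ α, inner ℝ (wderiv v α) (wderiv z α)‖ ≤ _
      rw [Finset.sum_mul]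
      refine (norm_sum_le _ _).trans (Finset.sum_le_sum fun α _ => ?_)
      exact (norm_inner_le_norm _ _).trans
        (mul_le_mul_of_nonneg_left (norm_wderiv_le z α) (norm_nonneg _))

theorem derivPairing_apply (v z : H1T T n) :
    derivPairing v z = ∑ α, inner ℝ (wderiv v α) (wderiv z α) := rfl

/-- The direct method: the action attains its minimum. -/
theorem exists_minimizer (hT : ∀ α, 0 < T α) {F : E p → E n → ℝ}
    (hF : ∀ x, AEMeasurable (fun t => F t x) (boxMeasure T))
    (hc : ∀ t ∈ box T, Continuous (F t)) {C : ℝ} (hC : ∀ t ∈ box T, ∀ x, ‖F t x‖ ≤ C)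
    (hpos : ∀ t ∈ box T, ∀ x, 0 ≤ F t x) {P : Fin n → ℝ} (hP : ∀ i, P i ≠ 0)
    (hper : ∀ i, ∀ t ∈ box T, ∀ x, F t (x + P i • EuclideanSpace.single i (1 : ℝ)) = F t x)
    (hlsc : IsWeaklyLSC fun u : H1T T n => potentialAction T F u) :
    ∃ u : H1T T n, ∀ v, action T F u ≤ action T F v := by
  have hact := action_eq hF hc hC
  have hpot : ∀ u : H1T T n, 0 ≤ potentialAction T F u := fun u =>
    integral_nonneg_of_ae (by filter_upwards [ae_mem_box] with t ht using hpos t ht _)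
  have hnn : ∀ u : H1T T n, 0 ≤ action T F u := fun u => by
    rw [hact]
    exact add_nonneg (mul_nonneg (by norm_num) (Finset.sum_nonneg fun _ _ => sq_nonneg _)) (hpot u)
  have hbdd : BddBelow (range fun u : H1T T n => action T F u) :=
    ⟨0, by rintro _ ⟨u, rfl⟩; exact hnn u⟩
  obtain ⟨r, hr_anti, hr_lim, hr_mem⟩ := exists_seq_tendsto_sInf (range_nonempty _) hbdd
  choose w hw using hr_mem
  choose u hud hup hum using fun k => exists_translate hT hP hper (w k)
  have hu : ∀ k, action T F (u k) = r k := fun k => by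
    rw [← hw k]
    simp only [hact, hud, hup]
  obtain ⟨V, K, hV, hK, hpw⟩ := poincare_wirtinger (n := n) hT
  -- The potential is nonnegative, so half the kinetic sum is at most `r k ≤ r 0`.
  have hkin : ∀ k, ∑ α, ‖wderiv (u k) α‖ ^ 2 ≤ 2 * r 0 := fun k => by
    have h1 := hu k
    rw [hact] at h1
    linarith [hr_anti (Nat.zero_le k), hpot (u k)]
  set B := ∑ j, ((boxMeasure T).real univ * P j) ^ 2 with hB
  have hnorm : ∀ k, ‖u k‖ ≤ Real.sqrt ((B + K * (2 * r 0)) / V + 2 * r 0) := fun k => by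
    refine Real.le_sqrt_of_sq_le ?_
    rw [H1T_norm_sq]
    refine add_le_add ?_ (hkin k)
    rw [le_div_iff₀' hV]
    refine (hpw (u k)).trans (add_le_add ?_ (mul_le_mul_of_nonneg_left (hkin k) hK))
    exact Finset.sum_le_sum fun j _ => sq_le_sq.2 (hum k j)
  obtain ⟨v, ns, hns, hv⟩ := exists_weakly_convergent_subseq (H := H1T T n) hnorm
  refine ⟨v, fun z => ?_⟩
  refine le_trans ?_ (csInf_le hbdd ⟨z, rfl⟩)
  refine le_of_forall_pos_le_add fun ε hε => ?_
  have h1 : ∀ᶠ k in atTop, potentialAction T F v - ε / 2 < potentialAction T F (u (ns k)) := by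
    have h2 : ((potentialAction T F v - ε / 2 : ℝ) : EReal) <
        liminf (fun k => ((potentialAction T F (u (ns k)) : ℝ) : EReal)) atTop :=
      lt_of_lt_of_le (EReal.coe_lt_coe_iff.2 (by linarith)) (hlsc (fun k => u (ns k)) v hv)
    filter_upwards [eventually_lt_of_lt_liminf h2] with k hk
    exact EReal.coe_lt_coe_iff.1 hk
  -- Lower semicontinuity of the kinetic term: the pairing with the derivatives of `v` is weakly
  -- continuous, and by `2xy ≤ x² + y²` it is at most the sum of the kinetic energies of `v` and `u
  -- (ns k)`.
  have h2 : ∀ᶠ k in atTop, derivPairing v v - ε / 2 < derivPairing v (u (ns k)) :=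
    (hv (derivPairing v)).eventually (lt_mem_nhds (by linarith))
  have h3 : Tendsto (fun k => r (ns k) + ε) atTop
      (𝓝 (sInf (range fun u : H1T T n => action T F u) + ε)) :=
    (hr_lim.comp hns.tendsto_atTop).add_const ε
  refine ge_of_tendsto h3 ?_
  filter_upwards [h1, h2] with k hk1 hk2
  rw [← hu, hact, hact]
  have h4 : derivPairing v (u (ns k)) ≤
      (1 / 2) * (∑ α, ‖wderiv v α‖ ^ 2) + (1 / 2) * ∑ α, ‖wderiv (u (ns k)) α‖ ^ 2 := by
    rw [derivPairing_apply, Finset.mul_sum, Finset.mul_sum, ← Finset.sum_add_distrib]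
    refine Finset.sum_le_sum fun α _ => ?_
    have := real_inner_le_norm (wderiv v α) (wderiv (u (ns k)) α)
    nlinarith [sq_nonneg (‖wderiv v α‖ - ‖wderiv (u (ns k)) α‖)]
  have h5 : derivPairing v v = ∑ α, ‖wderiv v α‖ ^ 2 := by
    simp only [derivPairing_apply, real_inner_self_eq_norm_sq]
  linarith

end PoissonGradient

end

theorem theorem4 (p n : ℕ) (T : Fin p → ℝ) (hT : ∀ α, 0 < T α)
    (F : PoissonGradient.E p → PoissonGradient.E n → ℝ)
    (hF_meas : ∀ x, AEMeasurable (fun t => F t x) (PoissonGradient.boxMeasure T))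
    (hF_C1 : ∀ t ∈ PoissonGradient.box T, ContDiff ℝ 1 (F t))
    (a : ℝ → ℝ) (ha_C1 : ContDiffOn ℝ 1 a (Set.Ici 0)) (ha_nonneg : ∀ r, 0 ≤ r → 0 ≤ a r)
    (ha_deriv : ∃ M : ℝ, ∀ r, 0 ≤ r → derivWithin a (Set.Ici 0) r ≤ M)
    (b : PoissonGradient.E p → ℝ) (hb_cont : ContinuousOn b (PoissonGradient.box T))
    (hb_nonneg : ∀ t ∈ PoissonGradient.box T, 0 ≤ b t)
    (hF_bound : ∀ t ∈ PoissonGradient.box T, ∀ x, |F t x| ≤ a ‖x‖ * b t)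
    (hF_grad_bound : ∀ t ∈ PoissonGradient.box T, ∀ x, ‖gradient (F t) x‖ ≤ a ‖x‖ * b t)
    (hF_pos : ∀ t ∈ PoissonGradient.box T, ∀ x, 0 < F t x)
    (P : Fin n → ℝ) (hP : ∀ i, P i ≠ 0)
    (hF_per : ∀ i, ∀ t ∈ PoissonGradient.box T, ∀ x,
      F t (x + P i • EuclideanSpace.single i (1 : ℝ)) = F t x)
    (hF_wlsc : PoissonGradient.IsWeaklyLSC
      (fun u : PoissonGradient.H1T T n => PoissonGradient.potentialAction T F u)) :
    ∃ u : PoissonGradient.H1T T n,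
      PoissonGradient.IsSolution T F u ∧
      ∀ v : PoissonGradient.H1T T n,
        PoissonGradient.action T F u ≤ PoissonGradient.action T F v := by
  obtain ⟨C, hC⟩ := PoissonGradient.exists_bound_of_periodic hP hF_per ha_C1.continuousOn hb_cont
    hF_bound
  obtain ⟨C', hC'⟩ := PoissonGradient.exists_bound_of_periodic
    (G := fun t x => gradient (F t) x) hP
    (fun i t ht x => PoissonGradient.gradient_periodic (hF_per i t ht) x) ha_C1.continuousOn hb_cont
    hF_grad_bound
  obtain ⟨u, hu⟩ := PoissonGradient.exists_minimizer hT hF_meas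
    (fun t ht => (hF_C1 t ht).continuous) hC (fun t ht x => (hF_pos t ht x).le) hP hF_per hF_wlsc
  obtain ⟨w, hw, hwF⟩ := PoissonGradient.exists_isWeakLaplacian_of_minimizer hT hF_meas hF_C1 hC
    hC' hu
  refine ⟨u, ⟨⟨w, hw, hwF⟩, PoissonGradient.equalTraces_toL2 hT u, fun i α => ?_⟩, hu⟩
  -- Since `Δu ∈ L²`, the derivative is itself in `H¹_T`, and the trace theorem applies to it.
  obtain ⟨z, hz⟩ := PoissonGradient.exists_toL2_eq_wderiv hT hw α
  rw [← hz]
  exact PoissonGradient.equalTraces_toL2 hT z i
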